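/- Let $a_1\in\mathbb R$, $a_2=0$, $X=[a_1,\infty)\times[a_2,\infty)$ with coordinates $x_1=x$, $x_2=t$, and let $p>0$. Let $M$ be relatively open in $X\times\mathbb R$ and let $\mathbf v=\xi^1\partial_{x}+\xi^2\partial_{t}+\phi\,\partial_u$ (write $\xi=\xi^1$, $\tau=\xi^2$) have coefficients real analytic on $M$ (up to the boundary of $X$). Let $u$ be real analytic on a relatively open $D\subseteq X$ (up to the boundary of $X$), with graph in $M$. *Notation.* For $q\in\mathbb R$ let $\langle q\rangle=\lfloor q\rfloor$ if $q\ge0$, $\langle q\rangle=-1$ if $q<0$; the Riemann–Liouville operator of order $q$ is $$D^q_{a,s}f(s)=\frac1{\Gamma(1+\langle q\rangle-q)}\frac{d^{\langle q\rangle+1}}{ds^{\langle q\rangle+1}}\int_a^s(s-r)^{\langle q\rangle-q}f(r)\,dr ,$$ and $D^q_{a,x_i}$ denotes the same operator in the variable $x_i$, the other variables being fixed. In $D^q_{a,x_i}\phi$, $D^q_{a,x_i}\partial_u\phi$, and in the partial derivatives $\partial_{x_i}^n\partial_u^k\phi$, the argument $u$ of $\phi$ is held fixed, at the value $u(x,t)$;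 $d^n/dx_i^n$ denotes total derivatives, i.e. derivatives of $\xi^l(x,t,u(x,t))$ and of powers of $u(x,t)$. $1/\Gamma$ is $0$ at the poles of $\Gamma$. Let $u^\sigma$, $\sigma=(\sigma_1,\sigma_2)\in\mathbb N_0^2$, be the coordinates for $\partial_x^{\sigma_1}\partial_t^{\sigma_2}u$ on the infinite jet space. For $\mathbf p=(p_1,p_2)$ the operator of order $\mathbf p$ is regarded as the function $$F_{\mathbf p}=\sum_\sigma\Big(\prod_{i=1}^2\binom{p_i}{\sigma_i}\frac{(x_i-a_i)^{\sigma_i-p_i}}{\Gamma(\sigma_i-p_i+1)}\Big)u^\sigma$$ on the jet space, and its prolonged coefficient is $$\phi^{\mathbf p}=\operatorname{pr}^\infty\mathbf v[F_{\mathbf p}]=\sum_i\xi^i\frac{\partial F_{\mathbf p}}{\partial x_i}+\sum_\sigma\phi^\sigma\frac{\partial F_{\mathbf p}}{\partial u^\sigma},\qquad \phi^\sigma=D^\sigma\Big(\phi-\sum_i\xi^i\partial_{x_i}u\Big)+\sum_i\xi^i\partial_{x_i}D^\sigma u,$$ where $D^\sigma$ are total derivatives; everything is evaluated along the jet of $u$.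 Put $\phi^p_t=\phi^{(0,p)}$ and $\phi^p_x=\phi^{(p,0)}$. *Statement.* (t) Suppose that the terminal $t=0$ is invariant: $\tau=0$ at all points of $M$ with $t=0$. Then $$\begin{aligned}\phi^p_t={}&D^p_{0,t}\phi+D^p_{0,t}u\Big(\partial_u\phi-p\frac{d\tau}{dt}\Big)-u\,D^p_{0,t}\partial_u\phi\\ &+\sum_{n=1}^\infty\Big\{\Big[\binom pn\partial_t^n\partial_u\phi-\binom p{n+1}\frac{d^{n+1}\tau}{dt^{n+1}}\Big]D^{p-n}_{0,t}u-\binom pn\frac{d^n\xi}{dt^n}\,\partial_xD^{p-n}_{0,t}u\Big\}\\ &+\sum_{n=2}^\infty\sum_{m=2}^n\sum_{k=2}^m\sum_{r=0}^{k-1}\binom pn\binom nm\binom kr\frac{t^{n-p}(-u)^r}{k!\,\Gamma(n+1-p)}\frac{d^m(u^{k-r})}{dt^m}\frac{\partial^{n-m+k}\phi}{\partial t^{n-m}\partial u^k},\end{aligned}$$ where moreover $F_{(0,p)}$ takes the value $D^p_{0,t}u$ at the jet of $u$, the partial derivatives of $F_{(0,p)}$ exist there, and the series over $\sigma$ and the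 two series over $n$ converge absolutely (the inner finite sums being carried out first), at each of the following points $(x,t)$ with $t>0$: (i) every point such that $\{x\}\times[0,t]\subseteq D$, $\{x\}\times[0,t]\times\{u(x,t)\}\subseteq M$, and the Taylor series in the variable $t$, at $(x,t)$, of $u$, $\partial_xu$, of $\phi,\xi,\tau$ composed with $u$, and of $\phi,\partial_u\phi$ with their argument $u$ fixed at $u(x,t)$, all have radius of convergence greater than $t$; (ii) without any such condition, every point of $X$ with $t>0$ that is sufficiently close to a given point $(x_0,0)\in D$. (x) If $\xi=0$ at all points of $M$ with $x=a_1$, the same holds for $\phi^p_x=\phi^{(p,0)}$ with the roles of $(t,0,\tau)$ and $(x,a_1,\xi)$ exchanged; the power $t^{n-p}$ becomes $(x-a_1)^{n-p}$. -/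

import Mathlib

open Filter Topology Set

noncomputable section

namespace FracLie

/-- The symbol `⟨p⟩`: the floor of `p` if `p ≥ 0`, and `-1` if `p < 0`. -/
def bracket (p : ℝ) : ℤ := if 0 ≤ p then ⌊p⌋ else -1

/-- The Riemann-Liouville operator of order `p ∈ ℝ` and terminals `(a, t)`. -/
def rl (p a : ℝ) (f : ℝ → ℝ) (t : ℝ) : ℝ :=
  1 / Real.Gamma (1 + bracket p - p) *
    iteratedDeriv (bracket p + 1).toNat
      (fun s => ∫ r in a..s, (s - r) ^ ((bracket p : ℝ) - p) * f r) t

/-- The base `ℝ²`; the coordinate `0` is `x`, the coordinate `1` is `t`. -/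
abbrev Base := Fin 2 → ℝ

/-- The partial derivative `∂ f / ∂ x_i`. -/
def pd (i : Fin 2) (f : Base → ℝ) (x : Base) : ℝ :=
  deriv (fun s => f (Function.update x i s)) (x i)

/-- The derivative `∂^σ f = ∂_{x_0}^{σ_0} ∂_{x_1}^{σ_1} f`. -/
def mpd (σ : Fin 2 → ℕ) (f : Base → ℝ) : Base → ℝ :=
  (pd 0)^[σ 0] ((pd 1)^[σ 1] f)

/-- The derivative `∂ f / ∂ u` of a function `f (x, u)`, with `x` held fixed. -/
def ud (f : Base × ℝ → ℝ) (z : Base × ℝ) : ℝ :=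
  deriv (fun w => f (z.1, w)) z.2

/-- The partial Riemann-Liouville operator of order `p` with respect to `x_i`,
with lower terminal `a`. -/
def prl (p a : ℝ) (i : Fin 2) (f : Base → ℝ) (x : Base) : ℝ :=
  rl p a (fun s => f (Function.update x i s)) (x i)

/-! ### The infinite jet space, in coordinates -/

/-- Points of the infinite jet space: the base point and the values of all coordinates `u^σ`. -/
abbrev Jet := Base × ((Fin 2 → ℕ) → ℝ)

/-- The infinite jet of `u` at `x`. -/
def jet (u : Base → ℝ) (x : Base) : Jet := (x, fun σ => mpd σ u x)

/-- The mixed operator of orders `p = (p_0, p_1)` and lower terminals `a`, as a function on the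
jet space:
`∑_σ ∏_i binom(p_i, σ_i) (x_i - a_i)^(σ_i - p_i) / Γ(σ_i - p_i + 1) u^σ`.
At the poles of `Γ` the quotient is `0`, as it should be. -/
def rlJet (p a : Fin 2 → ℝ) (z : Jet) : ℝ :=
  ∑' σ : Fin 2 → ℕ,
    (∏ i, Ring.choose (p i) (σ i) * (z.1 i - a i) ^ ((σ i : ℝ) - p i) /
      Real.Gamma ((σ i : ℝ) - p i + 1)) * z.2 σ

/-- The coefficient `φ^σ` of the infinite prolongation of
`∑ ξ^i ∂_{x_i} + φ ∂_u`, along the jet of `u`, where the total derivatives are the derivatives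
of the composed functions:
`φ^σ = D^σ (φ - ∑ ξ^i ∂_i u) + ∑ ξ^i ∂_i D^σ u`. For `σ = 0` it is `φ`. -/
def prolCoeff (ξ : Fin 2 → Base × ℝ → ℝ) (φ : Base × ℝ → ℝ) (u : Base → ℝ)
    (σ : Fin 2 → ℕ) (x : Base) : ℝ :=
  mpd σ (fun y => φ (y, u y) - ∑ i, ξ i (y, u y) * pd i u y) x
    + ∑ i, ξ i (x, u x) * pd i (mpd σ u) x

/-- `HasProl ξ φ u F x c`: the infinite prolongation
`∑ ξ^i ∂/∂x_i + ∑_σ φ^σ ∂/∂u^σ` can be applied to the function `F` at the jet of `u` at `x`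
(the partial derivatives of `F` exist there and the series converges), and the result is `c`. -/
def HasProl (ξ : Fin 2 → Base × ℝ → ℝ) (φ : Base × ℝ → ℝ) (u : Base → ℝ)
    (F : Jet → ℝ) (x : Base) (c : ℝ) : Prop :=
  ∃ (Fx : Fin 2 → ℝ) (Fu : (Fin 2 → ℕ) → ℝ) (S : ℝ),
    (∀ i, HasDerivAt (fun s => F (Function.update x i s, (jet u x).2)) (Fx i) (x i)) ∧
    (∀ σ, HasDerivAt (fun w => F (x, Function.update (jet u x).2 σ w)) (Fu σ) (mpd σ u x)) ∧
    HasSum (fun σ => prolCoeff ξ φ u σ x * Fu σ) S ∧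
    c = ∑ i, ξ i (x, u x) * Fx i + S

/-! ### The explicit formula, for the operator in the variable `x_i`; `j` is the other index -/

/-- The `n`-th term of the series in the operators of order `p - n`. -/
def seriesTerm (ξ : Fin 2 → Base × ℝ → ℝ) (φ : Base × ℝ → ℝ) (u : Base → ℝ)
    (p : ℝ) (a : Fin 2 → ℝ) (i j : Fin 2) (x : Base) (n : ℕ) : ℝ :=
  (Ring.choose p n * (pd i)^[n] (fun y => ud φ (y, u x)) x
      - Ring.choose p (n + 1) * (pd i)^[n + 1] (fun y => ξ i (y, u y)) x)
      * prl (p - n) (a i) i u x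
    - Ring.choose p n * (pd i)^[n] (fun y => ξ j (y, u y)) x
      * pd j (prl (p - n) (a i) i u) x

/-- The `n`-th term of the remainder of Osler type. -/
def oslerTerm (φ : Base × ℝ → ℝ) (u : Base → ℝ)
    (p : ℝ) (a : Fin 2 → ℝ) (i : Fin 2) (x : Base) (n : ℕ) : ℝ :=
  ∑ m ∈ Finset.Icc 2 n, ∑ k ∈ Finset.Icc 2 m, ∑ r ∈ Finset.range k,
    Ring.choose p n * (n.choose m : ℝ) * (k.choose r : ℝ)
      * ((x i - a i) ^ ((n : ℝ) - p) * (-u x) ^ r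
          / ((k.factorial : ℝ) * Real.Gamma ((n : ℝ) + 1 - p)))
      * (pd i)^[m] (fun y => u y ^ (k - r)) x
      * (pd i)^[n - m] (fun y => ud^[k] φ (y, u x)) x

/-- The right-hand side of the explicit formula. -/
def formulaRHS (ξ : Fin 2 → Base × ℝ → ℝ) (φ : Base × ℝ → ℝ) (u : Base → ℝ)
    (p : ℝ) (a : Fin 2 → ℝ) (i j : Fin 2) (x : Base) : ℝ :=
  prl p (a i) i (fun y => φ (y, u x)) x
    + prl p (a i) i u x * (ud φ (x, u x) - p * pd i (fun y => ξ i (y, u y)) x)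
    - u x * prl p (a i) i (fun y => ud φ (y, u x)) x
    + ∑' n : ℕ, seriesTerm ξ φ u p a i j x (n + 1)
    + ∑' n : ℕ, oslerTerm φ u p a i x (n + 2)

/-- The prolongation formula at `x`: the series representation of the operator of order `p` in
`x_i` (and order `0` in `x_j`) takes the value of that operator at the jet of `u`, the series in
the formula converge, and the prolonged coefficient exists and is given by the formula. -/
def ProlongationFormula (ξ : Fin 2 → Base × ℝ → ℝ) (φ : Base × ℝ → ℝ) (u : Base → ℝ)
    (p : ℝ) (a : Fin 2 → ℝ) (i j : Fin 2) (x : Base) : Prop :=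
  rlJet (Pi.single i p) a (jet u x) = prl p (a i) i u x ∧
  Summable (fun n : ℕ => seriesTerm ξ φ u p a i j x (n + 1)) ∧
  Summable (fun n : ℕ => oslerTerm φ u p a i x (n + 2)) ∧
  HasProl ξ φ u (rlJet (Pi.single i p) a) x (formulaRHS ξ φ u p a i j x)

/-! ### Points at which the Taylor series reach the lower terminal -/

/-- The Taylor series of `f` in the variable `x_i` at the point `x` has a radius of convergence
greater than the distance `x_i - a` to the lower terminal. -/
def TaylorReaches (a : ℝ) (i : Fin 2) (f : Base → ℝ) (x : Base) : Prop :=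
  ∃ C ρ : ℝ, x i - a < ρ ∧ ∀ n : ℕ, |(pd i)^[n] f x| ≤ C * (n.factorial : ℝ) / ρ ^ n

/-- The segment from `x` in direction `x_i` down to the terminal lies in the domain of `u`, it
lies in the domain `M` of the coefficients also when `u` is frozen at its value at `x`, and the
Taylor series at `x`, in the variable `x_i`, of all functions to which Riemann-Liouville
operators or total derivatives are applied reach the terminal. -/
structure Admissible (D : Set Base) (M : Set (Base × ℝ))
    (ξ : Fin 2 → Base × ℝ → ℝ) (φ : Base × ℝ → ℝ) (u : Base → ℝ)
    (a : Fin 2 → ℝ) (i j : Fin 2) (x : Base) : Prop where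
  above : a i < x i
  segment : ∀ s ∈ Icc (a i) (x i), Function.update x i s ∈ D
  frozen_segment : ∀ s ∈ Icc (a i) (x i), (Function.update x i s, u x) ∈ M
  taylor_u : TaylorReaches (a i) i u x
  taylor_pd_u : TaylorReaches (a i) i (pd j u) x
  taylor_phi : TaylorReaches (a i) i (fun y => φ (y, u y)) x
  taylor_xi : ∀ l, TaylorReaches (a i) i (fun y => ξ l (y, u y)) x
  taylor_phi_frozen : TaylorReaches (a i) i (fun y => φ (y, u x)) x
  taylor_ud_phi_frozen : TaylorReaches (a i) i (fun y => ud φ (y, u x)) x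

end FracLie

end

/-!
Everything reduces to one series. If the Taylor series of `f` at `t` has radius of convergence
greater than `t - a`, then for every real order `q`
`D^q f (t) = ∑ₙ c(q, n) (t - a)^(n - q) f⁽ⁿ⁾(t)`, with `c(q, n) = binom(q, n) / Γ(n - q + 1)`
(`rl_eq_rlSeries`). For `q < 0` this is the Taylor expansion of `f` at the upper end point,
integrated term by term against the kernel; each further unit of order is a termwise
differentiation in `t`, legitimate because the Cauchy estimates are locally uniform in the centre.

The right-hand side depends only on the sequence of derivatives of `f` at `t`, so the rest is
algebra of absolutely convergent series in such sequences (`rlSeries`). Its sources are the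
identities `binom(p, n) c(p - n, k) = binom(n + k, n) c(p, n + k)`, which gives the generalized
Leibniz rule (`hasSum_rlSeries_leibniz`), and `c(q, n) (n - q) = (-1)^n / (n! Γ(-q))`, which
bounds the coefficients and shows that `D^(q + 1) f - D^q f'` is a multiple of the value `f (a)`.

On the jet space only the coordinates `u^σ` with `σ` on the axis of `x_i` occur in the operator,
and along the jet of `u` the prolongation becomes a series in the derivatives of `φ (x, u)`, of
the products `ξ^l ∂_l u` and of `u`. The products are resolved by the Leibniz rule. For `l = i` the
function `ξ^i u` vanishes at the terminal, so that `D^p (ξ^i u)' = D^(p + 1) (ξ^i u)`, and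
the terms with `binom(p, n + 1)` result (`hasSum_transport`). For `l = j` one needs
`D^q ∂_j u = ∂_j D^q u` (`pd_prl_eq`). At neighbouring points the Taylor series of `u` may fail to
reach the terminal, so this is shown not with the series but by differentiating the integral,
transformed to a fixed interval. Finally, the derivatives of `φ (x, u)` are expanded in powers of
`u - u (x)` (`iteratedDeriv_comp_eq_osler`): the terms of degree `0` and `1` give `D^p φ` and,
by the Leibniz rule, the terms with `∂_u φ`; those of degree at least `2` form the remainder of
Osler type.

Near the terminal all the hypotheses on radii of convergence hold, because the Cauchy estimates are
uniform near a point while the distance to the terminal tends to `0` (`eventually_admissible`).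
-/

noncomputable section

namespace FracLie

lemma _root_.HasSum.of_eq {ι : Type*} {f g : ι → ℝ} {s t : ℝ} (h : HasSum f s)
    (hf : ∀ n, g n = f n) (hs : t = s) : HasSum g t := by
  rw [hs, funext hf]; exact h

/-! ### Coefficients of the series of the Riemann-Liouville operator -/

/-- The coefficient of `(t - a)^(n - q) f⁽ⁿ⁾(t)` in the expansion of the Riemann-Liouville operator
of order `q` at `t`. It is `0` at the poles of `Γ`, because `Real.Gamma` is `0` there. -/
def rlCoeff (q : ℝ) (n : ℕ) : ℝ := Ring.choose q n / Real.Gamma ((n : ℝ) - q + 1)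

lemma succ_mul_choose_succ (q : ℝ) (n : ℕ) :
    ((n : ℝ) + 1) * Ring.choose q (n + 1) = Ring.choose q n * (q - n) := by
  have h := Ring.choose_smul_choose q (Nat.le_succ n)
  simpa [Nat.choose_succ_self_right] using h

lemma div_Gamma_add_one (x : ℝ) : x / Real.Gamma (x + 1) = 1 / Real.Gamma x := by
  rcases eq_or_ne x 0 with rfl | hx
  · simp
  · rw [Real.Gamma_add_one hx, div_mul_cancel_left₀ hx, one_div]

lemma rlCoeff_mul_sub (q : ℝ) (n : ℕ) :
    rlCoeff q n * (n - q) = Ring.choose q n / Real.Gamma (n - q) := by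
  rw [rlCoeff, div_mul_eq_mul_div, mul_div_assoc, div_Gamma_add_one, mul_one_div]

/-- The closed form behind the growth of the coefficients, valid for every order `q`: both sides
vanish if `q` is a natural number. -/
lemma rlCoeff_mul_sub_eq (q : ℝ) (n : ℕ) :
    rlCoeff q n * (n - q) = (-1) ^ n / (n.factorial * Real.Gamma (-q)) := by
  rw [rlCoeff_mul_sub]
  induction n with
  | zero => simp
  | succ n ih =>
    have h1 := succ_mul_choose_succ q n
    have h2 := div_Gamma_add_one ((n : ℝ) - q)
    have hn : ((n : ℝ) + 1) ≠ 0 := by positivity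
    have e : Ring.choose q (n + 1) = Ring.choose q n * (q - n) / ((n : ℝ) + 1) := by
      rw [← h1]; field_simp
    have e2 : ((n + 1 : ℕ) : ℝ) - q = (n : ℝ) - q + 1 := by push_cast; ring
    rw [e, e2]
    calc Ring.choose q n * (q - n) / ((n : ℝ) + 1) / Real.Gamma ((n : ℝ) - q + 1)
        = -(Ring.choose q n / ((n : ℝ) + 1)) * (((n : ℝ) - q) / Real.Gamma ((n : ℝ) - q + 1)) := by
          ring
      _ = -(1 / ((n : ℝ) + 1)) * (Ring.choose q n / Real.Gamma ((n : ℝ) - q)) := by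
          rw [h2]; ring
      _ = _ := by
          rw [ih, Nat.factorial_succ, pow_succ]
          push_cast
          rw [← neg_div, div_mul_div_comm]
          congr 1 <;> ring

lemma rlCoeff_zero_mul (q : ℝ) : rlCoeff q 0 * (0 - q) = rlCoeff (q + 1) 0 := by
  have := rlCoeff_mul_sub q 0
  simp only [Nat.cast_zero] at this
  rw [this, rlCoeff]
  simp only [Ring.choose_zero_right, Nat.cast_zero]
  congr 2; ring

lemma rlCoeff_succ (q : ℝ) (n : ℕ) :
    rlCoeff q (n + 1) * ((n + 1 : ℕ) - q) + rlCoeff q n = rlCoeff (q + 1) (n + 1) := by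
  rw [rlCoeff_mul_sub, rlCoeff, rlCoeff, Ring.choose_succ_succ]
  have e1 : ((n + 1 : ℕ) : ℝ) - q = (n : ℝ) - q + 1 := by push_cast; ring
  have e2 : ((n + 1 : ℕ) : ℝ) - (q + 1) + 1 = (n : ℝ) - q + 1 := by push_cast; ring
  rw [e1, e2]; ring

lemma choose_mul_rlCoeff_sub (p : ℝ) (n k : ℕ) :
    Ring.choose p n * rlCoeff (p - n) k = ((n + k).choose n : ℝ) * rlCoeff p (n + k) := by
  have h := Ring.choose_smul_choose p (Nat.le_add_right n k)
  rw [Nat.add_sub_cancel_left, nsmul_eq_mul] at h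
  rw [rlCoeff, rlCoeff, ← mul_div_assoc, ← mul_div_assoc, h]
  congr 2; push_cast; ring

lemma exists_factorial_mul_abs_rlCoeff_le (q : ℝ) :
    ∃ K, 0 ≤ K ∧ ∀ n : ℕ, n.factorial * |rlCoeff q n| ≤ K := by
  obtain ⟨N, hN⟩ := exists_nat_ge (q + 1)
  refine ⟨∑ k ∈ Finset.range N, k.factorial * |rlCoeff q k| + |1 / Real.Gamma (-q)|,
    by positivity, fun n => ?_⟩
  rcases lt_or_ge n N with h | h
  · have := Finset.single_le_sum (f := fun k : ℕ => (k.factorial : ℝ) * |rlCoeff q k|)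
      (fun k _ => by positivity) (Finset.mem_range.2 h)
    have h0 := abs_nonneg (1 / Real.Gamma (-q))
    linarith
  · have hn : (1 : ℝ) ≤ n - q := by
      have : (N : ℝ) ≤ n := by exact_mod_cast h
      linarith
    have e : n.factorial * |rlCoeff q n| * (n - q) = |1 / Real.Gamma (-q)| := by
      have e' : |rlCoeff q n| * (n - q) = |rlCoeff q n * (n - q)| := by
        rw [abs_mul, abs_of_nonneg (by linarith : (0 : ℝ) ≤ n - q)]
      rw [mul_assoc, e', rlCoeff_mul_sub_eq, abs_div, abs_mul, abs_pow, abs_neg, abs_one, one_pow, Nat.abs_cast, abs_div, abs_one]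
      have : (n.factorial : ℝ) ≠ 0 := by positivity
      field_simp
    have h0 : 0 ≤ ∑ k ∈ Finset.range N, (k.factorial : ℝ) * |rlCoeff q k| := by positivity
    have h1 : n.factorial * |rlCoeff q n| ≤ n.factorial * |rlCoeff q n| * (n - q) :=
      le_mul_of_one_le_right (by positivity) hn
    linarith

/-! ### Sequences of derivatives whose Taylor series reaches the terminal -/

/-- The Taylor series with derivatives `A n` has radius of convergence greater than `τ`. -/
def Reaches (τ : ℝ) (A : ℕ → ℝ) : Prop :=
  ∃ C ρ : ℝ, τ < ρ ∧ ∀ n : ℕ, |A n| ≤ C * (n.factorial : ℝ) / ρ ^ n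

/-- The derivatives of a product, in terms of those of the factors. -/
def leibniz (A B : ℕ → ℝ) (N : ℕ) : ℝ :=
  ∑ k ∈ Finset.range (N + 1), (N.choose k : ℝ) * A k * B (N - k)

/-- The series of the Riemann-Liouville operator of order `q`, at distance `τ` from the terminal,
applied to a function with derivatives `A n`. -/
def rlSeries (q τ : ℝ) (A : ℕ → ℝ) : ℝ := ∑' n : ℕ, rlCoeff q n * τ ^ ((n : ℝ) - q) * A n

lemma rpow_natCast_sub {τ : ℝ} (hτ : 0 < τ) (q : ℝ) (n : ℕ) :
    τ ^ ((n : ℝ) - q) = τ ^ n * τ ^ (-q) := by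
  rw [sub_eq_add_neg, Real.rpow_add hτ, Real.rpow_natCast]

lemma reaches_iff {τ : ℝ} (hτ : 0 < τ) {A : ℕ → ℝ} :
    Reaches τ A ↔ ∃ C z : ℝ, 0 ≤ C ∧ 0 < z ∧ z < 1 ∧
      ∀ n : ℕ, |A n| * τ ^ n ≤ C * n.factorial * z ^ n := by
  constructor
  · rintro ⟨C, ρ, hρ, h⟩
    have hρ0 : 0 < ρ := hτ.trans hρ
    have hC : 0 ≤ C := by simpa using (abs_nonneg _).trans (h 0)
    refine ⟨C, τ / ρ, hC, by positivity, (div_lt_one hρ0).2 hρ, fun n => ?_⟩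
    calc |A n| * τ ^ n ≤ C * (n.factorial : ℝ) / ρ ^ n * τ ^ n := by gcongr; exact h n
      _ = _ := by rw [div_pow]; ring
  · rintro ⟨C, z, hC, hz, hz1, h⟩
    refine ⟨C, τ / z, (lt_div_iff₀ hz).2 (by nlinarith), fun n => ?_⟩
    rw [div_pow, div_div_eq_mul_div, le_div_iff₀ (by positivity)]
    exact h n

/-- A linear factor is absorbed by enlarging the ratio of a geometric sequence. -/
lemma exists_succ_mul_pow_le {z : ℝ} (hz : 0 < z) (hz1 : z < 1) :
    ∃ C w : ℝ, 0 ≤ C ∧ 0 < w ∧ w < 1 ∧ ∀ n : ℕ, ((n : ℝ) + 1) * z ^ n ≤ C * w ^ n := by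
  set w := (z + 1) / 2 with hw
  have hw0 : 0 < w := by positivity
  have hw1 : w < 1 := by rw [hw]; linarith
  have hzw : z / w < 1 := by rw [div_lt_one hw0, hw]; linarith
  have ht : Tendsto (fun n : ℕ => (n : ℝ) * (z / w) ^ n + (z / w) ^ n) atTop (𝓝 (0 + 0)) :=
    (tendsto_self_mul_const_pow_of_lt_one (by positivity) hzw).add
      (tendsto_pow_atTop_nhds_zero_of_lt_one (by positivity) hzw)
  obtain ⟨C, hC⟩ := ht.bddAbove_range
  have hC' : ∀ n : ℕ, (n : ℝ) * (z / w) ^ n + (z / w) ^ n ≤ C := fun n => hC ⟨n, rfl⟩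
  refine ⟨C, w, by have := hC' 0; simp at this; linarith, hw0, hw1, fun n => ?_⟩
  have e : ((n : ℝ) + 1) * z ^ n = ((n : ℝ) * (z / w) ^ n + (z / w) ^ n) * w ^ n := by
    rw [div_pow]; field_simp
  rw [e]
  exact mul_le_mul_of_nonneg_right (hC' n) (by positivity)

lemma Reaches.shift {τ : ℝ} (hτ : 0 < τ) {A : ℕ → ℝ} (h : Reaches τ A) :
    Reaches τ (fun n => A (n + 1)) := by
  obtain ⟨C, z, hC, hz, hz1, hA⟩ := (reaches_iff hτ).1 h
  obtain ⟨K, w, hK, hw, hw1, hKw⟩ := exists_succ_mul_pow_le hz hz1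
  refine (reaches_iff hτ).2 ⟨C * z * K / τ, w, by positivity, hw, hw1, fun n => ?_⟩
  have h1 := hA (n + 1)
  have h2 : |A (n + 1)| * τ ^ n = |A (n + 1)| * τ ^ (n + 1) / τ := by
    rw [pow_succ]; field_simp
  rw [h2, div_le_iff₀ hτ]
  refine h1.trans ?_
  rw [Nat.factorial_succ]
  push_cast
  calc C * (((n : ℝ) + 1) * n.factorial) * z ^ (n + 1)
      = C * z * n.factorial * (((n : ℝ) + 1) * z ^ n) := by rw [pow_succ]; ring
    _ ≤ C * z * n.factorial * (K * w ^ n) := by gcongr C * z * n.factorial * ?_; exact hKw n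
    _ = C * z * K / τ * n.factorial * w ^ n * τ := by field_simp

/-- Two sequences that reach the terminal do so with common constants. -/
lemma Reaches.exists_common {τ : ℝ} (hτ : 0 < τ) {A B : ℕ → ℝ} (hA : Reaches τ A)
    (hB : Reaches τ B) : ∃ C z : ℝ, 0 ≤ C ∧ 0 < z ∧ z < 1 ∧
      (∀ n : ℕ, |A n| * τ ^ n ≤ C * n.factorial * z ^ n) ∧
      ∀ n : ℕ, |B n| * τ ^ n ≤ C * n.factorial * z ^ n := by
  obtain ⟨C, z, hC, hz, hz1, hA⟩ := (reaches_iff hτ).1 hA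
  obtain ⟨C', z', hC', hz', hz1', hB⟩ := (reaches_iff hτ).1 hB
  refine ⟨max C C', max z z', by positivity, by positivity, max_lt hz1 hz1', fun n => ?_,
    fun n => ?_⟩
  · refine (hA n).trans ?_
    gcongr <;> exact le_max_left _ _
  · refine (hB n).trans ?_
    gcongr <;> exact le_max_right _ _

lemma Reaches.leibniz {τ : ℝ} (hτ : 0 < τ) {A B : ℕ → ℝ} (hA : Reaches τ A)
    (hB : Reaches τ B) : Reaches τ (leibniz A B) := by
  obtain ⟨C, z, hC, hz, hz1, hA, hB⟩ := hA.exists_common hτ hB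
  obtain ⟨K, w, hK, hw, hw1, hKw⟩ := exists_succ_mul_pow_le hz hz1
  refine (reaches_iff hτ).2 ⟨C * C * K, w, by positivity, hw, hw1, fun N => ?_⟩
  have hterm : ∀ k ∈ Finset.range (N + 1),
      |(N.choose k : ℝ) * A k * B (N - k)| * τ ^ N ≤ C * C * N.factorial * z ^ N := by
    intro k hk
    have hk' : k ≤ N := Nat.lt_succ_iff.1 (Finset.mem_range.1 hk)
    have e : τ ^ N = τ ^ k * τ ^ (N - k) := by rw [← pow_add, Nat.add_sub_cancel' hk']
    have e' : z ^ N = z ^ k * z ^ (N - k) := by rw [← pow_add, Nat.add_sub_cancel' hk']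
    have ef : (N.factorial : ℝ) = N.choose k * k.factorial * (N - k).factorial := by
      exact_mod_cast (Nat.choose_mul_factorial_mul_factorial hk').symm
    rw [abs_mul, abs_mul, Nat.abs_cast, e, e', ef]
    calc (N.choose k : ℝ) * |A k| * |B (N - k)| * (τ ^ k * τ ^ (N - k))
        = N.choose k * (|A k| * τ ^ k) * (|B (N - k)| * τ ^ (N - k)) := by ring
      _ ≤ N.choose k * (C * k.factorial * z ^ k) * (C * (N - k).factorial * z ^ (N - k)) := by
          gcongr N.choose k * ?_ * ?_
          · exact hA k
          · exact hB _
      _ = _ := by ring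
  calc |FracLie.leibniz A B N| * τ ^ N
      ≤ (∑ k ∈ Finset.range (N + 1), |(N.choose k : ℝ) * A k * B (N - k)|) * τ ^ N := by
        gcongr; exact Finset.abs_sum_le_sum_abs _ _
    _ ≤ ∑ k ∈ Finset.range (N + 1), C * C * N.factorial * z ^ N := by
        rw [Finset.sum_mul]; exact Finset.sum_le_sum hterm
    _ = C * C * N.factorial * (((N : ℝ) + 1) * z ^ N) := by simp; ring
    _ ≤ C * C * N.factorial * (K * w ^ N) := by gcongr C * C * N.factorial * ?_; exact hKw N
    _ = _ := by ring

lemma leibniz_shift (A B : ℕ → ℝ) (N : ℕ) :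
    leibniz A B (N + 1) = leibniz (fun n => A (n + 1)) B N + leibniz A (fun n => B (n + 1)) N := by
  have h := Finset.sum_choose_succ_mul (fun k l => A k * B l) N
  simp only [leibniz, mul_assoc]
  rw [h, add_comm]
  congr 1
  refine Finset.sum_congr rfl fun k hk => ?_
  rw [Nat.sub_add_comm (Nat.lt_succ_iff.1 (Finset.mem_range.1 hk))]

/-! ### The series of the Riemann-Liouville operator -/

lemma summable_rlSeries {τ : ℝ} (hτ : 0 < τ) (q : ℝ) {A : ℕ → ℝ} (hA : Reaches τ A) :
    Summable fun n : ℕ => rlCoeff q n * τ ^ ((n : ℝ) - q) * A n := by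
  obtain ⟨C, z, hC, hz, hz1, hA⟩ := (reaches_iff hτ).1 hA
  obtain ⟨K, hK, hc⟩ := exists_factorial_mul_abs_rlCoeff_le q
  refine Summable.of_norm_bounded (g := fun n => K * C * τ ^ (-q) * z ^ n)
    ((summable_geometric_of_lt_one hz.le hz1).mul_left _) fun n => ?_
  have hp : 0 < τ ^ (-q) := Real.rpow_pos_of_pos hτ _
  rw [Real.norm_eq_abs, abs_mul, abs_mul, rpow_natCast_sub hτ,
    abs_of_pos (by positivity : 0 < τ ^ n * τ ^ (-q))]
  calc |rlCoeff q n| * (τ ^ n * τ ^ (-q)) * |A n|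
      = |rlCoeff q n| * τ ^ (-q) * (|A n| * τ ^ n) := by ring
    _ ≤ |rlCoeff q n| * τ ^ (-q) * (C * n.factorial * z ^ n) := by gcongr |rlCoeff q n| * τ ^ (-q) * ?_; exact hA n
    _ = (n.factorial * |rlCoeff q n|) * C * τ ^ (-q) * z ^ n := by ring
    _ ≤ K * C * τ ^ (-q) * z ^ n := by gcongr; exact hc n

lemma hasSum_rlSeries {τ : ℝ} (hτ : 0 < τ) (q : ℝ) {A : ℕ → ℝ} (hA : Reaches τ A) :
    HasSum (fun n : ℕ => rlCoeff q n * τ ^ ((n : ℝ) - q) * A n) (rlSeries q τ A) :=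
  (summable_rlSeries hτ q hA).hasSum

lemma summable_taylor {τ : ℝ} (hτ : 0 < τ) {A : ℕ → ℝ} (hA : Reaches τ A) :
    Summable fun n : ℕ => (-τ) ^ n * A n / n.factorial := by
  obtain ⟨C, z, hC, hz, hz1, hA⟩ := (reaches_iff hτ).1 hA
  refine Summable.of_norm_bounded (g := fun n => C * z ^ n)
    ((summable_geometric_of_lt_one hz.le hz1).mul_left _) fun n => ?_
  rw [Real.norm_eq_abs, abs_div, abs_mul, abs_pow, abs_neg, abs_of_pos hτ, Nat.abs_cast,
    div_le_iff₀ (by positivity)]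
  calc τ ^ n * |A n| = |A n| * τ ^ n := mul_comm _ _
    _ ≤ _ := hA n
    _ = _ := by ring

/-- The terms that arise by differentiating the powers in the series sum to a multiple of the value
at the terminal. -/
lemma hasSum_rlCoeff_mul_sub {τ : ℝ} (hτ : 0 < τ) (q : ℝ) {A : ℕ → ℝ} (hA : Reaches τ A) :
    HasSum (fun n : ℕ => rlCoeff q n * (((n : ℝ) - q) * τ ^ ((n : ℝ) - q - 1)) * A n)
      (τ ^ (-q - 1) / Real.Gamma (-q) * ∑' n : ℕ, (-τ) ^ n * A n / n.factorial) := by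
  refine ((summable_taylor hτ hA).hasSum.mul_left (τ ^ (-q - 1) / Real.Gamma (-q))).of_eq
    (fun n => ?_) rfl
  have e : τ ^ ((n : ℝ) - q - 1) = τ ^ n * τ ^ (-q - 1) := by
    rw [sub_sub, rpow_natCast_sub hτ]; congr 2; ring
  rw [← mul_assoc, rlCoeff_mul_sub_eq, e, neg_pow τ n]
  ring

/-- Differentiation of the series, written with the derivatives `A (n + 1)` of the derivative. -/
lemma rlSeries_succ {τ : ℝ} (hτ : 0 < τ) (q : ℝ) {A : ℕ → ℝ} (hA : Reaches τ A) :
    HasSum (fun n : ℕ => rlCoeff q n * (((n : ℝ) - q) * τ ^ ((n : ℝ) - q - 1)) * A n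
      + rlCoeff q n * τ ^ ((n : ℝ) - q) * A (n + 1)) (rlSeries (q + 1) τ A) := by
  have h1 := hasSum_rlCoeff_mul_sub hτ q hA
  have h2 := hasSum_rlSeries hτ q (hA.shift hτ)
  have h3 := hasSum_rlSeries hτ (q + 1) hA
  convert h1.add h2 using 1
  refine h3.unique ?_
  rw [← hasSum_nat_add_iff' 1] at h1 ⊢
  have h4 := h1.add h2
  convert h4 using 1
  · funext n
    rw [← rlCoeff_succ]
    have e : τ ^ (((n + 1 : ℕ) : ℝ) - (q + 1)) = τ ^ ((n : ℝ) - q) := by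
      congr 1; push_cast; ring
    have e' : τ ^ (((n + 1 : ℕ) : ℝ) - q - 1) = τ ^ ((n : ℝ) - q) := by
      congr 1; push_cast; ring
    rw [e, e']; ring
  · have e : τ ^ (((0 : ℕ) : ℝ) - (q + 1)) = τ ^ (((0 : ℕ) : ℝ) - q - 1) := by
      congr 1; push_cast; ring
    simp only [Finset.sum_range_one]
    rw [← rlCoeff_zero_mul, e]
    push_cast
    ring

/-- If the value at the terminal is `0`, the operator of order `q + 1` is the operator of order `q`
applied to the derivative. -/
lemma rlSeries_succ_of_terminal_eq_zero {τ : ℝ} (hτ : 0 < τ) (q : ℝ) {A : ℕ → ℝ}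
    (hA : Reaches τ A) (h0 : ∑' n : ℕ, (-τ) ^ n * A n / n.factorial = 0) :
    rlSeries (q + 1) τ A = rlSeries q τ (fun n => A (n + 1)) := by
  have h1 := hasSum_rlCoeff_mul_sub hτ q hA
  rw [h0, mul_zero] at h1
  have := (rlSeries_succ hτ q hA).unique (h1.add (hasSum_rlSeries hτ q (hA.shift hτ)))
  simpa using this

/-- The value at the terminal is multiplicative. -/
lemma tsum_taylor_leibniz {τ : ℝ} (hτ : 0 < τ) {A B : ℕ → ℝ} (hA : Reaches τ A)
    (hB : Reaches τ B) :
    ∑' n : ℕ, (-τ) ^ n * leibniz A B n / n.factorial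
      = (∑' n : ℕ, (-τ) ^ n * A n / n.factorial) * ∑' n : ℕ, (-τ) ^ n * B n / n.factorial := by
  rw [tsum_mul_tsum_eq_tsum_sum_range_of_summable_norm (summable_taylor hτ hA).norm
    (summable_taylor hτ hB).norm]
  refine tsum_congr fun N => ?_
  rw [leibniz, Finset.mul_sum, Finset.sum_div]
  refine Finset.sum_congr rfl fun k hk => ?_
  have hk' : k ≤ N := Nat.lt_succ_iff.1 (Finset.mem_range.1 hk)
  have e : (-τ) ^ N = (-τ) ^ k * (-τ) ^ (N - k) := by rw [← pow_add, Nat.add_sub_cancel' hk']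
  have ef : (N.factorial : ℝ) = N.choose k * k.factorial * (N - k).factorial := by
    exact_mod_cast (Nat.choose_mul_factorial_mul_factorial hk').symm
  have hc : (N.choose k : ℝ) ≠ 0 := by exact_mod_cast (Nat.choose_pos hk').ne'
  rw [e, ef]
  field_simp

/-- The generalized Leibniz rule for the series of the Riemann-Liouville operator. -/
lemma hasSum_rlSeries_leibniz {τ : ℝ} (hτ : 0 < τ) (p : ℝ) {A B : ℕ → ℝ} (hA : Reaches τ A)
    (hB : Reaches τ B) :
    HasSum (fun n : ℕ => Ring.choose p n * B n * rlSeries (p - n) τ A)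
      (rlSeries p τ (leibniz B A)) := by
  obtain ⟨C, z, hC, hz, hz1, hA', hB'⟩ := hA.exists_common hτ hB
  obtain ⟨K, hK, hc⟩ := exists_factorial_mul_abs_rlCoeff_le p
  set g : ℕ × ℕ → ℝ := fun m => Ring.choose p m.1 * B m.1 *
    (rlCoeff (p - m.1) m.2 * τ ^ ((m.2 : ℝ) - (p - m.1)) * A m.2) with hg
  have hge : ∀ n k, g (n, k) =
      ((n + k).choose n : ℝ) * rlCoeff p (n + k) * τ ^ (((n + k : ℕ) : ℝ) - p) * B n * A k := by
    intro n k
    rw [← choose_mul_rlCoeff_sub, hg]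
    have : (k : ℝ) - (p - n) = ((n + k : ℕ) : ℝ) - p := by push_cast; ring
    simp only [this]; ring
  have hpp : 0 < τ ^ (-p) := Real.rpow_pos_of_pos hτ _
  have hs : Summable g := by
    have hgeo := summable_geometric_of_lt_one hz.le hz1
    have hprod := (hgeo.mul_of_nonneg hgeo (fun n => by positivity)
      (fun n => by positivity)).mul_left (K * τ ^ (-p) * C * C)
    refine Summable.of_norm_bounded hprod ?_
    rintro ⟨n, k⟩
    have hf : ((n + k).factorial : ℝ) = (n + k).choose n * n.factorial * k.factorial := by
      have := Nat.choose_mul_factorial_mul_factorial (Nat.le_add_right n k)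
      rw [Nat.add_sub_cancel_left] at this
      exact_mod_cast this.symm
    rw [hge, rpow_natCast_sub hτ, Real.norm_eq_abs]
    simp only [abs_mul, Nat.abs_cast, abs_of_pos hpp, abs_pow, abs_of_pos hτ]
    calc ((n + k).choose n : ℝ) * |rlCoeff p (n + k)| * (τ ^ (n + k) * τ ^ (-p)) * |B n| * |A k|
        = ((n + k).choose n : ℝ) * |rlCoeff p (n + k)| * τ ^ (-p) * (|B n| * τ ^ n)
            * (|A k| * τ ^ k) := by rw [pow_add]; ring
      _ ≤ ((n + k).choose n : ℝ) * |rlCoeff p (n + k)| * τ ^ (-p) * (C * n.factorial * z ^ n)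
            * (C * k.factorial * z ^ k) := by
          gcongr ((n + k).choose n : ℝ) * |rlCoeff p (n + k)| * τ ^ (-p) * ?_ * ?_
          · exact hB' n
          · exact hA' k
      _ = ((n + k).factorial * |rlCoeff p (n + k)|) * τ ^ (-p) * C * C * (z ^ n * z ^ k) := by
          rw [hf]; ring
      _ ≤ _ := by gcongr; exact hc _
  have h1 : HasSum (fun n : ℕ => Ring.choose p n * B n * rlSeries (p - n) τ A) (∑' m, g m) :=
    hs.hasSum.prod_fiberwise fun n => (hasSum_rlSeries hτ (p - n) hA).mul_left _
  have h2 : HasSum (fun N => ∑ m ∈ Finset.HasAntidiagonal.antidiagonal N, g m) (∑' m, g m) := by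
    have := (Finset.HasAntidiagonal.sigmaAntidiagonalEquivProd (A := ℕ)).hasSum_iff.2 hs.hasSum
    refine this.sigma fun N => ?_
    simp only [Function.comp_def, Finset.HasAntidiagonal.sigmaAntidiagonalEquivProd_apply]
    exact Finset.hasSum (Finset.HasAntidiagonal.antidiagonal N) g
  have h3 : ∀ N, ∑ m ∈ Finset.HasAntidiagonal.antidiagonal N, g m
      = rlCoeff p N * τ ^ ((N : ℝ) - p) * leibniz B A N := by
    intro N
    rw [Finset.Nat.sum_antidiagonal_eq_sum_range_succ_mk, leibniz, Finset.mul_sum]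
    refine Finset.sum_congr rfl fun k hk => ?_
    have hk' : k ≤ N := Nat.lt_succ_iff.1 (Finset.mem_range.1 hk)
    rw [hge, Nat.add_sub_cancel' hk']
    ring
  simp only [h3] at h2
  rwa [h2.unique (hasSum_rlSeries hτ p (hB.leibniz hτ hA))] at h1

/-- The transport part of the formula: the boundary term that would appear is proportional to the
value `∑ (-τ)^n X_n / n!` at the terminal. -/
lemma hasSum_transport {τ : ℝ} (hτ : 0 < τ) (p : ℝ) {X U : ℕ → ℝ} (hX : Reaches τ X)
    (hU : Reaches τ U) (h0 : ∑' n : ℕ, (-τ) ^ n * X n / n.factorial = 0) :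
    HasSum (fun n : ℕ => Ring.choose p (n + 1) * X (n + 1) * rlSeries (p - n) τ U)
      (rlSeries p τ (leibniz X (fun n => U (n + 1))) - X 0 * rlSeries (p + 1) τ U) := by
  have hX' := hX.shift hτ
  have h1 := hasSum_rlSeries_leibniz hτ (p + 1) hU hX
  have h2 := hasSum_rlSeries_leibniz hτ p hU hX'
  have hL : rlSeries (p + 1) τ (leibniz X U) = rlSeries p τ (leibniz (fun n => X (n + 1)) U)
      + rlSeries p τ (leibniz X (fun n => U (n + 1))) := by
    rw [rlSeries_succ_of_terminal_eq_zero hτ p (hX.leibniz hτ hU)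
      (by rw [tsum_taylor_leibniz hτ hX hU, h0, zero_mul])]
    have := (hasSum_rlSeries hτ p (hX'.leibniz hτ hU)).add
      (hasSum_rlSeries hτ p (hX.leibniz hτ (hU.shift hτ)))
    refine HasSum.unique (hasSum_rlSeries hτ p ((hX.leibniz hτ hU).shift hτ)) ?_
    refine this.of_eq (fun n => ?_) rfl
    rw [leibniz_shift]; ring
  rw [← hasSum_nat_add_iff' 1] at h1
  have h3 := h1.sub h2
  refine h3.of_eq (fun n => ?_) ?_
  · have e : p + 1 - ((n + 1 : ℕ) : ℝ) = p - n := by push_cast; ring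
    rw [Ring.choose_succ_succ, e]; ring
  · simp only [Finset.sum_range_one, Ring.choose_zero_right, Nat.cast_zero, sub_zero, hL]
    ring

/-! ### Cauchy estimates for real analytic functions, locally uniform in the centre -/

open scoped NNReal ENNReal in
/-- The coefficients of the re-centred power series satisfy a Cauchy estimate that is uniform in
the new centre. -/
lemma exists_changeOrigin_bound {E F : Type*} [NormedAddCommGroup E] [NormedSpace ℝ E]
    [NormedAddCommGroup F] [NormedSpace ℝ F] [CompleteSpace F]
    (P : FormalMultilinearSeries ℝ E F) {r r' : ℝ≥0}
    (h : ((r + r' : ℝ≥0) : ℝ≥0∞) < P.radius) :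
    ∃ C : ℝ, 0 ≤ C ∧ ∀ y : E, ‖y‖ ≤ r → ∀ k, ‖P.changeOrigin y k‖ * (r' : ℝ) ^ k ≤ C := by
  have hs := P.changeOriginSeries_summable_aux₁ (by exact_mod_cast h)
  refine ⟨((∑' s : Σ k l : ℕ, { s : Finset (Fin (k + l)) // s.card = l },
      ‖P (s.1 + s.2.1)‖₊ * r ^ s.2.1 * r' ^ s.1 : ℝ≥0) : ℝ), NNReal.coe_nonneg _,
    fun y hy k => ?_⟩
  have hy' : ‖y‖₊ ≤ r := hy
  have hr : (r : ℝ≥0∞) < P.radius :=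
    lt_of_le_of_lt (by exact_mod_cast (le_self_add : r ≤ r + r')) h
  have h1 := P.nnnorm_changeOrigin_le k (lt_of_le_of_lt (by exact_mod_cast hy') hr)
  have h2 := P.changeOriginSeries_summable_aux₂ hr k
  have h3 : (∑' s : Σ l : ℕ, { s : Finset (Fin (k + l)) // s.card = l },
      ‖P (k + s.1)‖₊ * ‖y‖₊ ^ s.1) ≤ ∑' s : Σ l : ℕ, { s : Finset (Fin (k + l)) // s.card = l },
      ‖P (k + s.1)‖₊ * r ^ s.1 := by
    refine Summable.tsum_le_tsum (fun s => by gcongr) (NNReal.summable_of_le (fun s => ?_) h2) h2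
    gcongr
  have h4 : ‖P.changeOrigin y k‖₊ * r' ^ k ≤ ∑' s : Σ k l : ℕ,
      { s : Finset (Fin (k + l)) // s.card = l }, ‖P (s.1 + s.2.1)‖₊ * r ^ s.2.1 * r' ^ s.1 := by
    calc ‖P.changeOrigin y k‖₊ * r' ^ k
        ≤ (∑' s : Σ l : ℕ, { s : Finset (Fin (k + l)) // s.card = l },
            ‖P (k + s.1)‖₊ * r ^ s.1) * r' ^ k := by gcongr; exact h1.trans h3
      _ = ∑' s : Σ l : ℕ, { s : Finset (Fin (k + l)) // s.card = l },
            ‖P (k + s.1)‖₊ * r ^ s.1 * r' ^ k := (NNReal.tsum_mul_right _ _).symm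
      _ ≤ ∑' k, ∑' s : Σ l : ℕ, { s : Finset (Fin (k + l)) // s.card = l },
            ‖P (k + s.1)‖₊ * r ^ s.1 * r' ^ k :=
          ((NNReal.summable_sigma.1 hs).2).le_tsum k (fun _ _ => zero_le)
      _ = _ := (hs.tsum_sigma' (fun k => (NNReal.summable_sigma.1 hs).1 k)).symm
  exact_mod_cast h4

/-- The derivatives along a line of a function with a power series. -/
lemma iteratedDeriv_line_eq {E : Type*} [NormedAddCommGroup E] [NormedSpace ℝ E]
    {f : E → ℝ} {P : FormalMultilinearSeries ℝ E ℝ} {z : E} (h : HasFPowerSeriesAt f P z)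
    (e : E) (s₀ : ℝ) (n : ℕ) :
    iteratedDeriv n (fun s : ℝ => f (z + (s - s₀) • e)) s₀ = n.factorial * P n (fun _ => e) := by
  have h1 : HasFPowerSeriesAt (fun y => f (z + y)) P 0 := by
    have := h.comp_sub (-z)
    simpa [add_comm] using this
  set u : ℝ →L[ℝ] E := ContinuousLinearMap.toSpanSingleton ℝ e with hu
  have h2 : HasFPowerSeriesAt ((fun y => f (z + y)) ∘ u) (P.compContinuousLinearMap u) 0 := by
    refine HasFPowerSeriesAt.compContinuousLinearMap ?_
    rwa [map_zero]
  obtain ⟨r, hr⟩ := h2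
  have h3 := hr.factorial_smul (1 : ℝ) n
  have h4 : iteratedDeriv n (fun s : ℝ => f (z + (s - s₀) • e)) s₀
      = iteratedDeriv n ((fun y => f (z + y)) ∘ u) 0 := by
    have := congrFun (iteratedDeriv_comp_sub_const n (fun s : ℝ => f (z + s • e)) s₀) s₀
    rw [sub_self] at this
    rw [this]; rfl
  rw [h4, iteratedDeriv_eq_iteratedFDeriv, ← h3, nsmul_eq_mul]
  congr 1
  rw [FormalMultilinearSeries.compContinuousLinearMap_apply]
  congr 1
  funext i
  simp [hu]

open scoped NNReal ENNReal in
/-- Cauchy estimates for the derivatives along lines, uniform in the centre. -/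
lemma _root_.HasFPowerSeriesOnBall.exists_iteratedDeriv_line_bound {E : Type*} [NormedAddCommGroup E]
    [NormedSpace ℝ E] {f : E → ℝ} {P : FormalMultilinearSeries ℝ E ℝ} {z₀ : E} {R : ℝ≥0∞}
    (hf : HasFPowerSeriesOnBall f P z₀ R) {r r' : ℝ≥0} (h : ((r + r' : ℝ≥0) : ℝ≥0∞) < R)
    {e : E} (he : ‖e‖ ≤ 1) :
    ∃ C : ℝ, 0 ≤ C ∧ ∀ z : E, ‖z - z₀‖ ≤ r → ∀ (s₀ : ℝ) (n : ℕ),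
      |iteratedDeriv n (fun s : ℝ => f (z + (s - s₀) • e)) s₀| * (r' : ℝ) ^ n
        ≤ C * n.factorial := by
  obtain ⟨C, hC, hb⟩ := exists_changeOrigin_bound P (h.trans_le hf.r_le)
  refine ⟨C, hC, fun z hz s₀ n => ?_⟩
  have hz' : (‖z - z₀‖₊ : ℝ≥0∞) < R := by
    refine lt_of_le_of_lt ?_ h
    have : ‖z - z₀‖₊ ≤ r + r' := le_trans hz le_self_add
    exact_mod_cast this
  have h1 : HasFPowerSeriesAt f (P.changeOrigin (z - z₀)) z := by
    have := (hf.changeOrigin hz').hasFPowerSeriesAt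
    rwa [add_sub_cancel] at this
  rw [iteratedDeriv_line_eq h1, abs_mul, Nat.abs_cast]
  have h2 : |P.changeOrigin (z - z₀) n fun _ => e| ≤ ‖P.changeOrigin (z - z₀) n‖ := by
    have := (P.changeOrigin (z - z₀) n).le_opNorm fun _ => e
    refine this.trans (mul_le_of_le_one_right (norm_nonneg _) ?_)
    exact Finset.prod_le_one (fun _ _ => norm_nonneg _) fun _ _ => he
  calc n.factorial * |P.changeOrigin (z - z₀) n fun _ => e| * (r' : ℝ) ^ n
      ≤ n.factorial * ‖P.changeOrigin (z - z₀) n‖ * (r' : ℝ) ^ n := by gcongr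
    _ = n.factorial * (‖P.changeOrigin (z - z₀) n‖ * (r' : ℝ) ^ n) := by ring
    _ ≤ n.factorial * C := by gcongr ?_ * ?_; exact hb _ hz n
    _ = _ := mul_comm _ _

open scoped NNReal ENNReal in
/-- Cauchy estimates on the line, uniform in the centre. -/
lemma _root_.HasFPowerSeriesOnBall.exists_iteratedDeriv_bound
    {g : ℝ → ℝ} {P : FormalMultilinearSeries ℝ ℝ ℝ} {t : ℝ} {ρ : ℝ≥0}
    (hg : HasFPowerSeriesOnBall g P t ρ) {d r : ℝ} (hd : 0 ≤ d) (hr : 0 ≤ r) (h : d + r < ρ) :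
    ∃ C : ℝ, 0 ≤ C ∧ ∀ s : ℝ, |s - t| ≤ d → ∀ n : ℕ,
      |iteratedDeriv n g s| * r ^ n ≤ C * n.factorial := by
  lift d to ℝ≥0 using hd
  lift r to ℝ≥0 using hr
  obtain ⟨C, hC, hb⟩ := hg.exists_iteratedDeriv_line_bound
    (r := d) (r' := r) (by exact_mod_cast h) (e := (1 : ℝ)) (by simp)
  refine ⟨C, hC, fun s hs n => ?_⟩
  simpa using hb s hs s n

/-! ### The Taylor expansion of the Riemann-Liouville operator -/

open scoped NNReal ENNReal in
/-- A function whose Taylor series at `t` reaches beyond the terminal `a` agrees, on the segment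
and near `t`, with the sum of that series. -/
lemma exists_hasFPowerSeriesOnBall {f : ℝ → ℝ} {a t : ℝ} (hat : a < t)
    (hf : AnalyticOnNhd ℝ f (Icc a t)) (hR : Reaches (t - a) (fun n => iteratedDeriv n f t)) :
    ∃ (g : ℝ → ℝ) (P : FormalMultilinearSeries ℝ ℝ ℝ) (ρ : ℝ≥0), t - a < ρ ∧
      HasFPowerSeriesOnBall g P t ρ ∧ EqOn f g (Icc a t) ∧ f =ᶠ[𝓝 t] g := by
  obtain ⟨C, ρ, hρ, hb⟩ := hR
  have hρ0 : 0 < ρ := (sub_pos.2 hat).trans hρ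
  lift ρ to ℝ≥0 using hρ0.le
  set P := FormalMultilinearSeries.ofScalars ℝ (fun n ↦ iteratedDeriv n f t / n.factorial) with hP
  have hrad : (ρ : ℝ≥0∞) ≤ P.radius := by
    refine P.le_radius_of_bound C fun n => ?_
    rw [hP, FormalMultilinearSeries.ofScalars_norm, norm_div, Real.norm_natCast, Real.norm_eq_abs,
      div_mul_eq_mul_div, div_le_iff₀ (by positivity)]
    have := hb n
    rwa [le_div_iff₀ (by positivity)] at this
  have hρ' : (0 : ℝ≥0∞) < ρ := by exact_mod_cast hρ0
  have hg : HasFPowerSeriesOnBall (fun s => P.sum (s - t)) P t ρ := by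
    have := (P.hasFPowerSeriesOnBall (hρ'.trans_le hrad)).comp_sub t
    rw [zero_add] at this
    exact this.mono hρ' hrad
  have heq : f =ᶠ[𝓝 t] fun s => P.sum (s - t) := by
    obtain ⟨r, hr⟩ := (hf t (right_mem_Icc.2 hat.le)).hasFPowerSeriesAt
    have hmin : 0 < min r ρ := lt_min hr.r_pos hρ'
    filter_upwards [Metric.eball_mem_nhds t hmin] with s hs
    exact (hr.mono hmin (min_le_left _ _)).unique (hg.mono hmin (min_le_right _ _)) hs
  refine ⟨_, P, ρ, hρ, hg, ?_, heq⟩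
  refine hf.eqOn_of_preconnected_of_eventuallyEq (hg.analyticOnNhd.mono fun s hs => ?_)
    isPreconnected_Icc (right_mem_Icc.2 hat.le) heq
  rw [Metric.eball_coe, Metric.mem_ball, Real.dist_eq, abs_lt]
  constructor <;> linarith [hs.1, hs.2]

section PowerSeries

open scoped NNReal ENNReal

variable {g : ℝ → ℝ} {P : FormalMultilinearSeries ℝ ℝ ℝ} {t : ℝ} {ρ : ℝ≥0}

lemma _root_.HasFPowerSeriesOnBall.hasSum_iteratedDeriv_of_mem (hg : HasFPowerSeriesOnBall g P t ρ)
    {s r : ℝ} (h : |s - t| + |r - s| < ρ) :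
    HasSum (fun n : ℕ => iteratedDeriv n g s / n.factorial * (r - s) ^ n) (g r) := by
  have hs : (‖s - t‖₊ : ℝ≥0∞) < ρ := by
    have : ‖s - t‖ < ρ := by rw [Real.norm_eq_abs]; linarith [abs_nonneg (r - s)]
    exact_mod_cast this
  have h1 := hg.changeOrigin hs
  rw [add_sub_cancel] at h1
  have hr : r - s ∈ Metric.eball (0 : ℝ) (ρ - ‖s - t‖₊) := by
    rw [Metric.mem_eball, edist_zero_right, enorm_eq_nnnorm, lt_tsub_iff_left]
    have : ‖s - t‖ + ‖r - s‖ < ρ := h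
    exact_mod_cast this
  have h2 := h1.hasSum_iteratedFDeriv hr
  rw [add_sub_cancel] at h2
  refine h2.of_eq (fun n => ?_) rfl
  rw [iteratedFDeriv_apply_eq_iteratedDeriv_mul_prod]
  simp only [Finset.prod_const, Finset.card_univ, Fintype.card_fin, smul_eq_mul]
  ring

/-- The Taylor series still reaches the terminal at neighbouring points. -/
lemma _root_.HasFPowerSeriesOnBall.reaches (hg : HasFPowerSeriesOnBall g P t ρ)
    {a s : ℝ} (has : a < s) (h : s - a + |s - t| < ρ) :
    Reaches (s - a) (fun n => iteratedDeriv n g s) := by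
  set η := ρ - (s - a) - |s - t| with hη
  obtain ⟨C, hC, hb⟩ := hg.exists_iteratedDeriv_bound
    (d := |s - t|) (r := s - a + η / 2) (abs_nonneg _) (by linarith) (by linarith)
  refine ⟨C, s - a + η / 2, by linarith, fun n => ?_⟩
  have : 0 < s - a + η / 2 := by linarith
  rw [le_div_iff₀ (by positivity)]
  exact hb s le_rfl n

end PowerSeries

lemma integral_rpow_mul_pow {a s e : ℝ} (has : a < s) (he : -1 < e) (n : ℕ) :
    ∫ r in a..s, (s - r) ^ e * (r - s) ^ n = (-1) ^ n * (s - a) ^ (e + n + 1) / (e + n + 1) := by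
  have h1 : ∀ r, (s - r) ^ e * (r - s) ^ n = (fun x : ℝ => x ^ e * (-x) ^ n) (s - r) := by
    intro r; simp
  simp only [h1]
  rw [intervalIntegral.integral_comp_sub_left (fun x : ℝ => x ^ e * (-x) ^ n), sub_self]
  have h2 : ∫ x in (0 : ℝ)..(s - a), x ^ e * (-x) ^ n
      = ∫ x in (0 : ℝ)..(s - a), (-1) ^ n * x ^ (e + n) := by
    refine intervalIntegral.integral_congr_ae (MeasureTheory.ae_of_all _ fun x hx => ?_)
    rw [uIoc_of_le (by linarith)] at hx
    rw [Real.rpow_add hx.1, Real.rpow_natCast, neg_pow x n]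
    ring
  have hn : (0 : ℝ) ≤ n := n.cast_nonneg
  rw [h2, intervalIntegral.integral_const_mul, integral_rpow (Or.inl (by linarith)),
    Real.zero_rpow (by linarith)]
  ring

open scoped NNReal ENNReal in
/-- The fractional integral (an operator of negative order), expanded at the upper end point. -/
lemma _root_.HasFPowerSeriesOnBall.fractionalIntegral_eq {g : ℝ → ℝ}
    {P : FormalMultilinearSeries ℝ ℝ ℝ} {t : ℝ} {ρ : ℝ≥0} (hg : HasFPowerSeriesOnBall g P t ρ)
    {a s q : ℝ} (hq : q < 0) (has : a < s) (h : s - a + |s - t| < ρ) :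
    1 / Real.Gamma (-q) * ∫ r in a..s, (s - r) ^ (-q - 1) * g r
      = rlSeries q (s - a) (fun n => iteratedDeriv n g s) := by
  have hτ : 0 < s - a := sub_pos.2 has
  have hreach := hg.reaches has h
  have hint : IntervalIntegrable (fun r : ℝ => (s - r) ^ (-q - 1)) MeasureTheory.volume a s := by
    have := (intervalIntegral.intervalIntegrable_rpow' (a := s - a) (b := 0)
      (by linarith : -1 < -q - 1)).comp_sub_left s
    simpa using this
  have hmem : ∀ r ∈ uIoc a s, 0 ≤ s - r ∧ |r - s| ≤ s - a := by
    intro r hr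
    rw [uIoc_of_le has.le] at hr
    exact ⟨by linarith [hr.2], by rw [abs_le]; constructor <;> linarith [hr.1, hr.2]⟩
  have hsum : Summable fun n : ℕ => |iteratedDeriv n g s| / n.factorial * (s - a) ^ n := by
    refine (summable_taylor hτ hreach).norm.congr fun n => ?_
    rw [Real.norm_eq_abs, abs_div, abs_mul, abs_pow, abs_neg, abs_of_pos hτ, Nat.abs_cast]
    ring
  have key := intervalIntegral.hasSum_integral_of_dominated_convergence
    (μ := MeasureTheory.volume) (a := a) (b := s)
    (F := fun (n : ℕ) r => (s - r) ^ (-q - 1) * (iteratedDeriv n g s / n.factorial * (r - s) ^ n))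
    (f := fun r => (s - r) ^ (-q - 1) * g r)
    (fun (n : ℕ) r => (s - r) ^ (-q - 1)
      * (|iteratedDeriv n g s| / n.factorial * (s - a) ^ n))
    (fun n => by
      have : Measurable fun r : ℝ => (s - r) ^ (-q - 1)
          * (iteratedDeriv n g s / n.factorial * (r - s) ^ n) := by fun_prop
      exact this.aestronglyMeasurable)
    (fun n => MeasureTheory.ae_of_all _ fun r hr => by
      obtain ⟨h0, h1⟩ := hmem r hr
      have hp := Real.rpow_nonneg h0 (-q - 1)
      rw [Real.norm_eq_abs, abs_mul, abs_of_nonneg hp, abs_mul, abs_div, Nat.abs_cast, abs_pow]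
      gcongr)
    (MeasureTheory.ae_of_all _ fun r _ => hsum.mul_left _)
    (by
      simp only [tsum_mul_left]
      exact hint.mul_const _)
    (MeasureTheory.ae_of_all _ fun r hr => by
      obtain ⟨h0, h1⟩ := hmem r hr
      exact (hg.hasSum_iteratedDeriv_of_mem (by linarith)).mul_left _)
  have key' := key.mul_left (1 / Real.Gamma (-q))
  refine (HasSum.unique (key'.of_eq (fun n => ?_) rfl) (hasSum_rlSeries hτ q hreach))
  have h1 : ∀ r, (s - r) ^ (-q - 1) * (iteratedDeriv n g s / n.factorial * (r - s) ^ n)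
      = iteratedDeriv n g s / n.factorial * ((s - r) ^ (-q - 1) * (r - s) ^ n) := by
    intro r; ring
  simp only [h1]
  rw [intervalIntegral.integral_const_mul, integral_rpow_mul_pow has (by linarith)]
  have hnq : (0 : ℝ) < n - q := by have : (0 : ℝ) ≤ n := n.cast_nonneg; linarith
  have hc : rlCoeff q n = (-1) ^ n / (n.factorial * Real.Gamma (-q)) / (n - q) := by
    rw [← rlCoeff_mul_sub_eq, mul_div_cancel_right₀ _ hnq.ne']
  have e : -q - 1 + (n : ℝ) + 1 = n - q := by ring
  rw [hc, e, div_div]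
  have : Real.Gamma (-q) ≠ 0 := (Real.Gamma_pos_of_pos (by linarith)).ne'
  field_simp

section PowerSeries

open scoped NNReal ENNReal

variable {g : ℝ → ℝ} {P : FormalMultilinearSeries ℝ ℝ ℝ} {t : ℝ} {ρ : ℝ≥0}

lemma _root_.HasFPowerSeriesOnBall.hasDerivAt_iteratedDeriv (hg : HasFPowerSeriesOnBall g P t ρ)
    {s : ℝ} (hs : |s - t| < ρ) (n : ℕ) :
    HasDerivAt (iteratedDeriv n g) (iteratedDeriv (n + 1) g s) s := by
  have han : AnalyticAt ℝ g s := by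
    refine hg.analyticOnNhd s ?_
    rw [Metric.eball_coe, Metric.mem_ball, Real.dist_eq]
    exact hs
  rw [iteratedDeriv_succ]
  rw [iteratedDeriv_eq_iterate]
  exact (han.iterated_deriv n).differentiableAt.hasDerivAt

/-- Termwise differentiation in `s` of the expansion at `s` raises the order by one. -/
lemma _root_.HasFPowerSeriesOnBall.hasDerivAt_rlSeries (hg : HasFPowerSeriesOnBall g P t ρ)
    {a s₀ : ℝ} (q : ℝ) (has : a < s₀) (h : s₀ - a + |s₀ - t| < ρ) :
    HasDerivAt (fun s => rlSeries q (s - a) (fun n => iteratedDeriv n g s))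
      (rlSeries (q + 1) (s₀ - a) (fun n => iteratedDeriv n g s₀)) s₀ := by
  set η := ρ - (s₀ - a) - |s₀ - t| with hη
  have hη0 : 0 < η := by linarith
  -- On a ball of radius `δ` around `s₀` all series are dominated by one geometric series.
  set δ := min (η / 4) ((s₀ - a) / 2) with hδ
  have hδ0 : 0 < δ := lt_min (by linarith) (by linarith)
  have hδ1 : δ ≤ η / 4 := min_le_left _ _
  have hδ2 : δ ≤ (s₀ - a) / 2 := min_le_right _ _
  set τ := s₀ - a + δ with hτ
  set r := τ + δ with hr
  have hτ0 : 0 < τ := by linarith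
  have hr0 : 0 < r := by linarith
  obtain ⟨C, hC, hb⟩ := hg.exists_iteratedDeriv_bound
    (d := |s₀ - t| + δ) (r := r) (by positivity) hr0.le (by linarith)
  obtain ⟨K, hK, hc⟩ := exists_factorial_mul_abs_rlCoeff_le q
  have hball : ∀ s ∈ Metric.ball s₀ δ, |s - t| ≤ |s₀ - t| + δ ∧ (s₀ - a) / 2 ≤ s - a ∧
      s - a ≤ τ := by
    intro s hs
    rw [Metric.mem_ball, Real.dist_eq] at hs
    have h1 := abs_lt.1 hs
    refine ⟨?_, by linarith, by linarith⟩
    calc |s - t| = |(s - s₀) + (s₀ - t)| := by ring_nf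
      _ ≤ |s - s₀| + |s₀ - t| := abs_add_le _ _
      _ ≤ _ := by linarith
  have hD : ∀ s ∈ Metric.ball s₀ δ, ∀ n : ℕ,
      |iteratedDeriv n g s| ≤ C * n.factorial / r ^ n := by
    intro s hs n
    rw [le_div_iff₀ (by positivity)]
    exact hb s (hball s hs).1 n
  have hM' : ∀ e : ℝ, ∃ M : ℝ, 0 ≤ M ∧ ∀ s ∈ Metric.ball s₀ δ, (s - a) ^ e ≤ M := by
    intro e
    refine ⟨((s₀ - a) / 2) ^ e + τ ^ e,
      add_nonneg (Real.rpow_nonneg (by linarith) _) (Real.rpow_nonneg hτ0.le _), fun s hs => ?_⟩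
    obtain ⟨-, h1, h2⟩ := hball s hs
    have p1 : 0 ≤ ((s₀ - a) / 2) ^ e := Real.rpow_nonneg (by linarith) _
    have p2 : 0 ≤ τ ^ e := Real.rpow_nonneg hτ0.le _
    rcases le_total 0 e with he | he
    · have := Real.rpow_le_rpow (by linarith) h2 he
      linarith
    · have := Real.rpow_le_rpow_of_nonpos (by linarith) h1 he
      linarith
  obtain ⟨M, hM0, hM⟩ := hM' (-q)
  obtain ⟨N, hN0, hN⟩ := hM' (-q - 1)
  have hz1 : τ / r < 1 := by rw [div_lt_one hr0]; linarith
  obtain ⟨L, w, hL, hw, hw1, hLw⟩ := exists_succ_mul_pow_le (div_pos hτ0 hr0) hz1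
  have hmem0 : s₀ ∈ Metric.ball s₀ δ := Metric.mem_ball_self hδ0
  have hreach := hg.reaches has h
  have key := hasDerivAt_tsum_of_isPreconnected (𝕜 := ℝ) (t := Metric.ball s₀ δ)
    (y₀ := s₀) (y := s₀)
    (g := fun (n : ℕ) s => rlCoeff q n * (s - a) ^ ((n : ℝ) - q) * iteratedDeriv n g s)
    (g' := fun (n : ℕ) s =>
      rlCoeff q n * (((n : ℝ) - q) * (s - a) ^ ((n : ℝ) - q - 1)) * iteratedDeriv n g s
      + rlCoeff q n * (s - a) ^ ((n : ℝ) - q) * iteratedDeriv (n + 1) g s)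
    (u := fun n => |1 / Real.Gamma (-q)| * N * C * (τ / r) ^ n + K * M * C / r * (L * w ^ n))
    (((summable_geometric_of_lt_one (by positivity) hz1).mul_left _).add
      (((summable_geometric_of_lt_one hw.le hw1).mul_left _).mul_left _))
    Metric.isOpen_ball (convex_ball s₀ δ).isPreconnected ?_ ?_ hmem0
    (summable_rlSeries (sub_pos.2 has) q hreach) hmem0
  · rw [(rlSeries_succ (sub_pos.2 has) q hreach).tsum_eq] at key
    exact key
  · intro n s hs
    obtain ⟨h1, h2, h3⟩ := hball s hs
    have hsa : 0 < s - a := by linarith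
    have e1 : HasDerivAt (fun s => (s - a) ^ ((n : ℝ) - q))
        (((n : ℝ) - q) * (s - a) ^ ((n : ℝ) - q - 1)) s := by
      have := ((hasDerivAt_id s).sub_const a).rpow_const (p := (n : ℝ) - q) (Or.inl hsa.ne')
      simpa using this
    exact (e1.const_mul (rlCoeff q n)).mul
      (hg.hasDerivAt_iteratedDeriv (by linarith) n)
  · intro n s hs
    obtain ⟨h1, h2, h3⟩ := hball s hs
    have hsa : 0 < s - a := by linarith
    have p1 : 0 ≤ (s - a) ^ (-q) := Real.rpow_nonneg hsa.le _
    have p2 : 0 ≤ (s - a) ^ (-q - 1) := Real.rpow_nonneg hsa.le _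
    have e1 : (s - a) ^ ((n : ℝ) - q - 1) = (s - a) ^ n * (s - a) ^ (-q - 1) := by
      rw [sub_sub, rpow_natCast_sub hsa]; congr 2; ring
    have hpow : (s - a) ^ n ≤ τ ^ n := by gcongr
    rw [Real.norm_eq_abs]
    refine (abs_add_le _ _).trans (add_le_add ?_ ?_)
    · rw [← mul_assoc, rlCoeff_mul_sub_eq, e1, abs_mul, abs_mul, abs_div, abs_mul, abs_pow,
        abs_neg, abs_one, one_pow, Nat.abs_cast, abs_of_nonneg (by positivity : 0 ≤
          (s - a) ^ n * (s - a) ^ (-q - 1))]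
      calc 1 / (n.factorial * |Real.Gamma (-q)|) * ((s - a) ^ n * (s - a) ^ (-q - 1))
            * |iteratedDeriv n g s|
          ≤ 1 / (n.factorial * |Real.Gamma (-q)|) * (τ ^ n * N) * (C * n.factorial / r ^ n) := by
            gcongr
            · exact hN s hs
            · exact hD s hs n
        _ = |1 / Real.Gamma (-q)| * N * C * (τ / r) ^ n := by
            rw [abs_div, abs_one, div_pow, one_div, mul_inv]
            have : (n.factorial : ℝ) ≠ 0 := by positivity
            field_simp
    · rw [rpow_natCast_sub hsa, abs_mul, abs_mul, abs_of_nonneg (by positivity : 0 ≤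
          (s - a) ^ n * (s - a) ^ (-q))]
      calc |rlCoeff q n| * ((s - a) ^ n * (s - a) ^ (-q)) * |iteratedDeriv (n + 1) g s|
          ≤ |rlCoeff q n| * (τ ^ n * M) * (C * (n + 1).factorial / r ^ (n + 1)) := by
            gcongr
            · exact hM s hs
            · exact hD s hs (n + 1)
        _ = (n.factorial * |rlCoeff q n|) * M * C / r * (((n : ℝ) + 1) * (τ / r) ^ n) := by
            rw [Nat.factorial_succ, div_pow, pow_succ]
            push_cast
            field_simp
        _ ≤ K * M * C / r * (L * w ^ n) := by
            gcongr ?_ * M * C / r * ?_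
            · exact hc n
            · exact hLw n

/-- Orders `q + k` with `q < 0` are reached by `k` termwise differentiations. -/
lemma _root_.HasFPowerSeriesOnBall.iteratedDeriv_fractionalIntegral (hg : HasFPowerSeriesOnBall g P t ρ)
    {a q : ℝ} (hq : q < 0) (k : ℕ) {s : ℝ} (has : a < s) (h : s - a + |s - t| < ρ) :
    iteratedDeriv k (fun s => 1 / Real.Gamma (-q) * ∫ r in a..s, (s - r) ^ (-q - 1) * g r) s
      = rlSeries (q + k) (s - a) (fun n => iteratedDeriv n g s) := by
  induction k generalizing s with
  | zero =>
    rw [iteratedDeriv_zero, Nat.cast_zero, add_zero]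
    exact hg.fractionalIntegral_eq hq has h
  | succ k ih =>
    rw [iteratedDeriv_succ]
    have hev : iteratedDeriv k (fun s => 1 / Real.Gamma (-q)
        * ∫ r in a..s, (s - r) ^ (-q - 1) * g r)
        =ᶠ[𝓝 s] fun s => rlSeries (q + k) (s - a) (fun n => iteratedDeriv n g s) := by
      have hcont : ContinuousAt (fun s => s - a + |s - t|) s := by fun_prop
      filter_upwards [lt_mem_nhds has, hcont.eventually_lt continuousAt_const h] with s' h1 h2
      exact ih h1 h2
    rw [hev.deriv_eq, (hg.hasDerivAt_rlSeries (q + k) has h).deriv]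
    congr 1; push_cast; ring

end PowerSeries

/-- The number of derivatives in the definition of the Riemann-Liouville operator exceeds the
order. -/
lemma order_sub_toNat_neg (q : ℝ) : q - ((bracket q + 1).toNat : ℝ) < 0 ∧
    1 + (bracket q : ℝ) - q = -(q - ((bracket q + 1).toNat : ℝ)) := by
  unfold bracket
  split_ifs with h
  · have h0 : (0 : ℤ) ≤ ⌊q⌋ := Int.floor_nonneg.2 h
    have h1 : (((⌊q⌋ + 1).toNat : ℕ) : ℝ) = (⌊q⌋ : ℝ) + 1 := by
      have : (((⌊q⌋ + 1).toNat : ℕ) : ℤ) = ⌊q⌋ + 1 := Int.toNat_of_nonneg (by lia)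
      exact_mod_cast this
    rw [h1]
    exact ⟨by linarith [Int.lt_floor_add_one q], by ring⟩
  · norm_num
    exact not_le.1 h

/-- The expansion of the Riemann-Liouville operator of any real order in the derivatives at the
upper end point, if the Taylor series there reaches the terminal. -/
theorem rl_eq_rlSeries {f : ℝ → ℝ} {a t : ℝ} (q : ℝ) (hat : a < t)
    (hf : AnalyticOnNhd ℝ f (Icc a t)) (hR : Reaches (t - a) (fun n => iteratedDeriv n f t)) :
    rl q a f t = rlSeries q (t - a) (fun n => iteratedDeriv n f t) := by
  obtain ⟨g, P, ρ, hρ, hg, heqOn, heq⟩ := exists_hasFPowerSeriesOnBall hat hf hR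
  obtain ⟨hneg, hexp⟩ := order_sub_toNat_neg q
  set k := (bracket q + 1).toNat with hk
  have h1 := hg.iteratedDeriv_fractionalIntegral hneg k hat
    (by simpa using hρ)
  have h2 : ∀ n, iteratedDeriv n f t = iteratedDeriv n g t := fun n => heq.iteratedDeriv_eq n
  simp only [h2]
  rw [sub_add_cancel] at h1
  rw [← h1, iteratedDeriv_const_mul_field, rl, hexp]
  congr 1
  refine Filter.EventuallyEq.iteratedDeriv_eq _ ?_
  obtain ⟨ε, hε, hball⟩ := Metric.eventually_nhds_iff_ball.1 heq
  filter_upwards [Metric.ball_mem_nhds t hε, lt_mem_nhds hat] with s hs has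
  refine intervalIntegral.integral_congr fun r hr => ?_
  rw [uIcc_of_le has.le] at hr
  have hfr : f r = g r := by
    rcases le_total r t with h | h
    · exact heqOn ⟨hr.1, h⟩
    · refine hball r ?_
      rw [Metric.mem_ball, Real.dist_eq, abs_lt] at hs ⊢
      constructor <;> linarith [hr.2]
  have e : (bracket q : ℝ) - q = -(q - (k : ℝ)) - 1 := by linarith
  simp only [hfr, e]

/-! ### Partial derivatives of real analytic functions -/

/-- Iterated partial derivatives are derivatives along a coordinate line, without any assumption on
the function. -/
lemma pd_iterate_update (i : Fin 2) (f : Base → ℝ) (x : Base) (n : ℕ) (s : ℝ) :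
    (pd i)^[n] f (Function.update x i s)
      = iteratedDeriv n (fun s => f (Function.update x i s)) s := by
  induction n generalizing s with
  | zero => simp
  | succ n ih =>
    rw [Function.iterate_succ_apply', iteratedDeriv_succ, pd]
    simp only [Function.update_idem, Function.update_self]
    exact congrArg (fun h : ℝ → ℝ => deriv h s) (funext ih)

lemma pd_iterate_eq (i : Fin 2) (f : Base → ℝ) (x : Base) (n : ℕ) :
    (pd i)^[n] f x = iteratedDeriv n (fun s => f (Function.update x i s)) (x i) := by
  rw [← pd_iterate_update, Function.update_eq_self]

lemma pd_congr {f g : Base → ℝ} {x : Base} (i : Fin 2) (h : f =ᶠ[𝓝 x] g) :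
    pd i f =ᶠ[𝓝 x] pd i g := by
  filter_upwards [eventually_eventually_nhds.2 h] with y hy
  refine Filter.EventuallyEq.deriv_eq ?_
  have ht : Tendsto (fun s => Function.update y i s) (𝓝 (y i)) (𝓝 y) := by
    have : Continuous fun s => Function.update y i s := by fun_prop
    simpa using this.tendsto (y i)
  exact ht.eventually hy

lemma pd_eq_fderiv {f : Base → ℝ} {x : Base} (i : Fin 2) (h : DifferentiableAt ℝ f x) :
    pd i f x = fderiv ℝ f x (Pi.single i 1) := by
  have h1 : HasFDerivAt f (fderiv ℝ f x) (Function.update x i (x i)) := by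
    rw [Function.update_eq_self]; exact h.hasFDerivAt
  exact (h1.comp_hasDerivAt (x i) (hasDerivAt_update x i (x i))).deriv

lemma hasDerivAt_update_pd {f : Base → ℝ} {x : Base} (i : Fin 2) {s : ℝ}
    (h : DifferentiableAt ℝ f (Function.update x i s)) :
    HasDerivAt (fun s => f (Function.update x i s)) (pd i f (Function.update x i s)) s := by
  rw [pd_eq_fderiv i h]
  exact h.hasFDerivAt.comp_hasDerivAt s (hasDerivAt_update x i s)

lemma pd_eventuallyEq_fderiv {f : Base → ℝ} {x : Base} (i : Fin 2) (h : AnalyticAt ℝ f x) :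
    pd i f =ᶠ[𝓝 x] fun y => fderiv ℝ f y (Pi.single i 1) :=
  h.eventually_analyticAt.mono fun _ hy => pd_eq_fderiv i hy.differentiableAt

lemma _root_.AnalyticAt.pd {f : Base → ℝ} {x : Base} (i : Fin 2) (h : AnalyticAt ℝ f x) :
    AnalyticAt ℝ (pd i f) x := by
  refine AnalyticAt.congr ?_ (pd_eventuallyEq_fderiv i h).symm
  exact (ContinuousLinearMap.apply ℝ ℝ (Pi.single i 1 : Base)).analyticAt _ |>.comp h.fderiv

lemma _root_.AnalyticAt.pd_iterate {f : Base → ℝ} {x : Base} (i : Fin 2) (n : ℕ)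
    (h : AnalyticAt ℝ f x) : AnalyticAt ℝ ((FracLie.pd i)^[n] f) x := by
  induction n with
  | zero => simpa
  | succ n ih => rw [Function.iterate_succ_apply']; exact ih.pd i

lemma pd_comm {f : Base → ℝ} {x : Base} (i j : Fin 2) (h : AnalyticAt ℝ f x) :
    pd i (pd j f) x = pd j (pd i f) x := by
  have key : ∀ i j : Fin 2, pd i (pd j f) x
      = fderiv ℝ (fderiv ℝ f) x (Pi.single i 1) (Pi.single j 1) := by
    intro i j
    have hd : DifferentiableAt ℝ (fderiv ℝ f) x := h.fderiv.differentiableAt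
    rw [(pd_congr i (pd_eventuallyEq_fderiv j h)).eq_of_nhds,
      pd_eq_fderiv i (hd.clm_apply (differentiableAt_const _)),
      fderiv_clm_apply hd (differentiableAt_const _)]
    simp
  rw [key, key]
  exact (h.contDiffAt (n := ⊤)).isSymmSndFDerivAt (by simp) _ _

lemma pd_iterate_comm {f : Base → ℝ} {x : Base} (i j : Fin 2) (n : ℕ) (h : AnalyticAt ℝ f x) :
    pd j ((pd i)^[n] f) =ᶠ[𝓝 x] (pd i)^[n] (pd j f) := by
  induction n with
  | zero => rfl
  | succ n ih =>
    rw [Function.iterate_succ_apply', Function.iterate_succ_apply']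
    refine EventuallyEq.trans ?_ (pd_congr i ih)
    exact h.eventually_analyticAt.mono fun y hy => pd_comm j i (hy.pd_iterate i n)

/-! ### Differentiation of the Riemann-Liouville operator with respect to a parameter -/

/-- The points near which a function is analytic along a compact segment contain a neighbourhood
of that segment. -/
lemma eventually_forall_Icc_analyticAt {H : ℝ × ℝ → ℝ} {z₀ a b : ℝ}
    (h : ∀ θ ∈ Icc a b, AnalyticAt ℝ H (z₀, θ)) :
    ∀ᶠ z in 𝓝 z₀, ∀ θ ∈ Icc a b, AnalyticAt ℝ H (z, θ) := by
  refine isCompact_Icc.eventually_forall_of_forall_eventually fun θ hθ => ?_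
  exact (h θ hθ).eventually_analyticAt

lemma hasDerivAt_fst {H : ℝ × ℝ → ℝ} {z θ : ℝ} (h : AnalyticAt ℝ H (z, θ)) :
    HasDerivAt (fun z => H (z, θ)) (fderiv ℝ H (z, θ) (1, 0)) z :=
  h.differentiableAt.hasFDerivAt.comp_hasDerivAt z
    ((hasDerivAt_id z).prodMk (hasDerivAt_const z θ))

/-- Differentiation under the integral sign, with an integrable weight. -/
lemma hasDerivAt_integral_mul {w : ℝ → ℝ} {H : ℝ × ℝ → ℝ} {H' : ℝ → ℝ} {z₀ : ℝ}
    (hw : IntervalIntegrable w MeasureTheory.volume 0 1)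
    (h : ∀ θ ∈ Icc (0 : ℝ) 1, AnalyticAt ℝ H (z₀, θ))
    (hH' : ∀ θ ∈ Icc (0 : ℝ) 1, HasDerivAt (fun z => H (z, θ)) (H' θ) z₀) :
    HasDerivAt (fun z => ∫ θ in (0 : ℝ)..1, w θ * H (z, θ))
      (∫ θ in (0 : ℝ)..1, w θ * H' θ) z₀ := by
  obtain ⟨δ, hδ, hball⟩ :=
    Metric.nhds_basis_closedBall.eventually_iff.1 (eventually_forall_Icc_analyticAt h)
  have hU : uIoc (0 : ℝ) 1 ⊆ Icc 0 1 := by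
    rw [uIoc_of_le zero_le_one]; exact Ioc_subset_Icc_self
  have hcont : ∀ z ∈ Metric.closedBall z₀ δ, ContinuousOn (fun θ => H (z, θ)) (uIcc 0 1) := by
    intro z hz θ hθ
    rw [uIcc_of_le zero_le_one] at hθ
    have : ContinuousAt (fun θ => H (z, θ)) θ :=
      ContinuousAt.comp (f := fun θ => (z, θ)) (hball hz θ hθ).continuousAt (by fun_prop)
    exact this.continuousWithinAt
  have hcont' : ContinuousOn (fun y : ℝ × ℝ => fderiv ℝ H y (1, 0))
      (Metric.closedBall z₀ δ ×ˢ Icc 0 1) := by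
    rintro ⟨z, θ⟩ ⟨hz, hθ⟩
    exact ((hball hz θ hθ).fderiv.continuousAt.clm_apply continuousAt_const).continuousWithinAt
  obtain ⟨B, hB⟩ := ((isCompact_closedBall z₀ δ).prod isCompact_Icc).exists_bound_of_continuousOn
    hcont'
  have hz₀ : z₀ ∈ Metric.closedBall z₀ δ := Metric.mem_closedBall_self hδ.le
  have key := intervalIntegral.hasDerivAt_integral_of_dominated_loc_of_deriv_le
    (μ := MeasureTheory.volume) (a := 0) (b := 1)
    (F := fun z θ => w θ * H (z, θ)) (F' := fun z θ => w θ * fderiv ℝ H (z, θ) (1, 0))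
    (bound := fun θ => ‖w θ‖ * B) (x₀ := z₀)
    (Metric.closedBall_mem_nhds z₀ hδ)
    (by
      filter_upwards [Metric.closedBall_mem_nhds z₀ hδ] with z hz
      exact (hw.mul_continuousOn (hcont z hz)).aestronglyMeasurable_restrict_uIoc)
    (hw.mul_continuousOn (hcont z₀ hz₀))
    (by
      have : ContinuousOn (fun θ => fderiv ℝ H (z₀, θ) (1, 0)) (uIcc 0 1) := by
        refine hcont'.comp (f := fun θ => (z₀, θ)) (by fun_prop) fun θ hθ => ⟨hz₀, ?_⟩
        rwa [uIcc_of_le zero_le_one] at hθ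
      exact (hw.mul_continuousOn this).aestronglyMeasurable_restrict_uIoc)
    (MeasureTheory.ae_of_all _ fun θ hθ z hz => by
      rw [norm_mul]
      gcongr
      exact hB (z, θ) ⟨hz, hU hθ⟩)
    (hw.norm.mul_const B)
    (MeasureTheory.ae_of_all _ fun θ hθ z hz =>
      (hasDerivAt_fst (hball hz θ (hU hθ))).const_mul _)
  refine key.2.congr_deriv ?_
  refine intervalIntegral.integral_congr (E := ℝ) fun θ hθ => ?_
  rw [uIcc_of_le zero_le_one] at hθ
  rw [(hH' θ hθ).unique (hasDerivAt_fst (h θ hθ))]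

/-- The integrals over the unit interval to which the kernel integral, rescaled, and its
derivatives reduce. -/
def rescaledIntegral (e a : ℝ) (f : ℝ → ℝ) (m : ℕ) (s : ℝ) : ℝ :=
  ∫ θ in (0 : ℝ)..1, (1 - θ) ^ e * (θ ^ m * iteratedDeriv m f (a + (s - a) * θ))

lemma intervalIntegrable_one_sub_rpow {e : ℝ} (he : -1 < e) :
    IntervalIntegrable (fun θ : ℝ => (1 - θ) ^ e) MeasureTheory.volume 0 1 := by
  have := (intervalIntegral.intervalIntegrable_rpow' (a := 1) (b := 0) he).comp_sub_left 1
  simpa using this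

lemma integral_kernel_eq_rescaledIntegral {e a s : ℝ} (has : a < s) (f : ℝ → ℝ) :
    ∫ r in a..s, (s - r) ^ e * f r = (s - a) ^ (e + 1) * rescaledIntegral e a f 0 s := by
  have hτ : 0 < s - a := sub_pos.2 has
  have h := intervalIntegral.integral_comp_add_mul (a := 0) (b := 1)
    (fun r => (s - r) ^ e * f r) hτ.ne' a
  simp only [mul_zero, add_zero, mul_one, add_sub_cancel, smul_eq_mul] at h
  have h2 : ∫ r in a..s, (s - r) ^ e * f r
      = (s - a) * ∫ x in (0 : ℝ)..1, (s - (a + (s - a) * x)) ^ e * f (a + (s - a) * x) := by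
    rw [h, mul_inv_cancel_left₀ hτ.ne']
  rw [h2, rescaledIntegral, Real.rpow_add hτ, Real.rpow_one, mul_comm ((s - a) ^ e), mul_assoc,
    ← intervalIntegral.integral_const_mul ((s - a) ^ e)]
  congr 1
  refine intervalIntegral.integral_congr (E := ℝ) fun θ hθ => ?_
  rw [uIcc_of_le zero_le_one] at hθ
  have e1 : s - (a + (s - a) * θ) = (s - a) * (1 - θ) := by ring
  simp only [e1, pow_zero, one_mul, iteratedDeriv_zero]
  rw [Real.mul_rpow hτ.le (by linarith [hθ.2])]
  ring

lemma mem_Icc_of_unit {a s θ : ℝ} (has : a ≤ s) (hθ : θ ∈ Icc (0 : ℝ) 1) :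
    a + (s - a) * θ ∈ Icc a s := by
  constructor
  · nlinarith [hθ.1, hθ.2]
  · nlinarith [hθ.1, hθ.2]

lemma analyticAt_iteratedDeriv {f : ℝ → ℝ} {s : ℝ} (h : AnalyticAt ℝ f s) (m : ℕ) :
    AnalyticAt ℝ (iteratedDeriv m f) s := by
  rw [iteratedDeriv_eq_iterate]; exact h.iterated_deriv m

lemma hasDerivAt_rescaledIntegral {e a b : ℝ} (he : -1 < e) {f : ℝ → ℝ}
    (hf : AnalyticOnNhd ℝ f (Ico a b)) (m : ℕ) {s : ℝ} (hs : s ∈ Ioo a b) :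
    HasDerivAt (rescaledIntegral e a f m) (rescaledIntegral e a f (m + 1) s) s := by
  have hmem : ∀ θ ∈ Icc (0 : ℝ) 1, a + (s - a) * θ ∈ Ico a b := fun θ hθ =>
    ⟨(mem_Icc_of_unit hs.1.le hθ).1, (mem_Icc_of_unit hs.1.le hθ).2.trans_lt hs.2⟩
  refine hasDerivAt_integral_mul
    (H := fun y => y.2 ^ m * iteratedDeriv m f (a + (y.1 - a) * y.2))
    (intervalIntegrable_one_sub_rpow he) (fun θ hθ => ?_) fun θ hθ => ?_
  · have h1 := analyticAt_iteratedDeriv (hf _ (hmem θ hθ)) m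
    have h2 : AnalyticAt ℝ (fun y : ℝ × ℝ => a + (y.1 - a) * y.2) (s, θ) :=
      analyticAt_const.add ((analyticAt_fst.sub analyticAt_const).mul analyticAt_snd)
    have h3 : AnalyticAt ℝ (fun y : ℝ × ℝ => y.2 ^ m) (s, θ) :=
      analyticAt_snd.pow m
    exact h3.mul (AnalyticAt.fun_comp (f := fun y : ℝ × ℝ => a + (y.1 - a) * y.2) h1 h2)
  · have h1 := (analyticAt_iteratedDeriv (hf _ (hmem θ hθ)) m).differentiableAt.hasDerivAt
    rw [← iteratedDeriv_succ] at h1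
    have h2 : HasDerivAt (fun z : ℝ => a + (z - a) * θ) θ s := by
      simpa using (((hasDerivAt_id s).sub_const a).mul_const θ).const_add a
    have h3 := (h1.comp s h2).const_mul (θ ^ m)
    refine h3.congr_deriv ?_
    rw [pow_succ]; ring

lemma contDiffOn_rescaledIntegral {e a b : ℝ} (he : -1 < e) {f : ℝ → ℝ}
    (hf : AnalyticOnNhd ℝ f (Ico a b)) (k m : ℕ) :
    ContDiffOn ℝ k (rescaledIntegral e a f m) (Ioo a b) := by
  induction k generalizing m with
  | zero =>
    rw [Nat.cast_zero, contDiffOn_zero]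
    exact fun s hs =>
      (hasDerivAt_rescaledIntegral he hf m hs).continuousAt.continuousWithinAt
  | succ k ih =>
    rw [Nat.cast_succ, contDiffOn_succ_iff_deriv_of_isOpen isOpen_Ioo]
    refine ⟨fun s hs => (hasDerivAt_rescaledIntegral he hf m hs).differentiableAt
      |>.differentiableWithinAt, by simp, ?_⟩
    exact (ih (m + 1)).congr fun s hs => (hasDerivAt_rescaledIntegral he hf m hs).deriv

lemma iteratedDeriv_rescaledIntegral {e a b : ℝ} (he : -1 < e) {f : ℝ → ℝ}
    (hf : AnalyticOnNhd ℝ f (Ico a b)) (m : ℕ) {s : ℝ} (hs : s ∈ Ioo a b) :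
    iteratedDeriv m (rescaledIntegral e a f 0) s = rescaledIntegral e a f m s := by
  induction m generalizing s with
  | zero => simp
  | succ m ih =>
    have : iteratedDeriv m (rescaledIntegral e a f 0) =ᶠ[𝓝 s] rescaledIntegral e a f m := by
      filter_upwards [isOpen_Ioo.mem_nhds hs] with s' hs' using ih hs'
    rw [iteratedDeriv_succ, this.deriv_eq, (hasDerivAt_rescaledIntegral he hf m hs).deriv]

lemma _root_.AnalyticOnNhd.exists_Ico {f : ℝ → ℝ} {a t : ℝ} (hat : a < t)
    (hf : AnalyticOnNhd ℝ f (Icc a t)) : ∃ b, t < b ∧ AnalyticOnNhd ℝ f (Ico a b) := by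
  obtain ⟨ε, hε, hb⟩ :=
    Metric.eventually_nhds_iff_ball.1 (hf t (right_mem_Icc.2 hat.le)).eventually_analyticAt
  refine ⟨t + ε, by linarith, fun s hs => ?_⟩
  rcases le_total s t with h | h
  · exact hf s ⟨hs.1, h⟩
  · refine hb s ?_
    rw [Metric.mem_ball, Real.dist_eq, abs_lt]
    constructor <;> linarith [hs.2]

/-- The derivatives of the kernel integral as a finite sum of integrals over a fixed interval. -/
lemma iteratedDeriv_integral_kernel {e a t : ℝ} (he : -1 < e) (hat : a < t) {f : ℝ → ℝ}
    (hf : AnalyticOnNhd ℝ f (Icc a t)) (k : ℕ) :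
    iteratedDeriv k (fun s => ∫ r in a..s, (s - r) ^ e * f r) t
      = ∑ m ∈ Finset.range (k + 1), (k.choose m : ℝ)
        * iteratedDeriv m (fun s => (s - a) ^ (e + 1)) t * rescaledIntegral e a f (k - m) t := by
  obtain ⟨b, hb, hf⟩ := AnalyticOnNhd.exists_Ico hat hf
  have ht : t ∈ Ioo a b := ⟨hat, hb⟩
  have hev : (fun s => ∫ r in a..s, (s - r) ^ e * f r)
      =ᶠ[𝓝 t] (fun s => (s - a) ^ (e + 1)) * rescaledIntegral e a f 0 := by
    filter_upwards [lt_mem_nhds hat] with s hs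
    exact integral_kernel_eq_rescaledIntegral hs f
  have h1 : ContDiffAt ℝ k (fun s : ℝ => (s - a) ^ (e + 1)) t :=
    (contDiffAt_id.sub contDiffAt_const).rpow_const_of_ne (sub_pos.2 hat).ne'
  rw [hev.iteratedDeriv_eq k, iteratedDeriv_mul h1
    ((contDiffOn_rescaledIntegral he hf k 0).contDiffAt (isOpen_Ioo.mem_nhds ht))]
  refine Finset.sum_congr rfl fun m _ => ?_
  rw [iteratedDeriv_rescaledIntegral he hf _ ht]

lemma bracket_sub_gt (q : ℝ) : -1 < (bracket q : ℝ) - q := by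
  have := order_sub_toNat_neg q
  linarith [this.1, this.2]

section Parameter

variable {u : Base → ℝ} {x : Base} {i j : Fin 2} {a : ℝ}

lemma analyticAt_update_update (hij : i ≠ j) {y s : ℝ}
    (hu : AnalyticAt ℝ u (Function.update (Function.update x j y) i s)) :
    AnalyticAt ℝ (fun z : ℝ × ℝ => u (Function.update (Function.update x j z.1) i z.2)) (y, s) := by
  refine AnalyticAt.fun_comp (g := u)
    (f := fun z : ℝ × ℝ => Function.update (Function.update x j z.1) i z.2) hu ?_
  rw [analyticAt_pi_iff]
  intro l
  rcases eq_or_ne l i with rfl | hli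
  · simpa using analyticAt_snd
  · have hlj : l = j := by lia
    subst hlj
    simpa [hli] using analyticAt_fst

lemma _root_.AnalyticAt.comp_update {s : ℝ} (hu : AnalyticAt ℝ u (Function.update x i s)) :
    AnalyticAt ℝ (fun s => u (Function.update x i s)) s := by
  refine AnalyticAt.fun_comp (g := u) (f := fun s => Function.update x i s) hu ?_
  rw [analyticAt_pi_iff]
  intro l
  rcases eq_or_ne l i with rfl | hli
  · simp only [Function.update_self]
    exact analyticAt_id
  · simpa [hli] using analyticAt_const

lemma hasDerivAt_rescaledIntegral_parameter {e : ℝ} (he : -1 < e) (hij : i ≠ j) (hax : a < x i)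
    (hu : ∀ s ∈ Icc a (x i), AnalyticAt ℝ u (Function.update x i s)) (m : ℕ) :
    HasDerivAt (fun y => rescaledIntegral e a
        (fun s => u (Function.update (Function.update x j y) i s)) m (x i))
      (rescaledIntegral e a (fun s => pd j u (Function.update x i s)) m (x i)) (x j) := by
  have hmem : ∀ θ ∈ Icc (0 : ℝ) 1,
      AnalyticAt ℝ u (Function.update x i (a + (x i - a) * θ)) := fun θ hθ =>
    hu _ (mem_Icc_of_unit hax.le hθ)
  unfold rescaledIntegral
  simp only [← pd_iterate_update]
  refine hasDerivAt_integral_mul (H := fun z => z.2 ^ m * (pd i)^[m] u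
      (Function.update (Function.update x j z.1) i (a + (x i - a) * z.2)))
    (intervalIntegrable_one_sub_rpow he) (fun θ hθ => ?_) fun θ hθ => ?_
  · have h3 : AnalyticAt ℝ (fun y : ℝ × ℝ => y.2 ^ m) (x j, θ) := analyticAt_snd.pow m
    refine h3.mul ?_
    have h1 : AnalyticAt ℝ ((pd i)^[m] u) (Function.update (Function.update x j (x j)) i
        (a + (x i - a) * θ)) := by
      rw [Function.update_eq_self]; exact (hmem θ hθ).pd_iterate i m
    have h2 : AnalyticAt ℝ (fun z : ℝ × ℝ => (z.1, a + (x i - a) * z.2)) (x j, θ) :=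
      analyticAt_fst.prod (analyticAt_const.add (analyticAt_const.mul analyticAt_snd))
    exact AnalyticAt.fun_comp (f := fun z : ℝ × ℝ => (z.1, a + (x i - a) * z.2))
      (analyticAt_update_update hij h1) h2
  · refine HasDerivAt.const_mul (θ ^ m) ?_
    have h1 := hmem θ hθ
    simp only [Function.update_comm hij.symm]
    have hxj : Function.update x i (a + (x i - a) * θ) j = x j := Function.update_of_ne hij.symm _ _
    have h2 : Function.update (Function.update x i (a + (x i - a) * θ)) j (x j)
        = Function.update x i (a + (x i - a) * θ) := by
      conv_lhs => rw [← hxj]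
      exact Function.update_eq_self _ _
    rw [← (pd_iterate_comm i j m h1).eq_of_nhds]
    have h3 := hasDerivAt_update_pd (f := (pd i)^[m] u)
      (x := Function.update x i (a + (x i - a) * θ)) j (s := x j)
      (by rw [h2]; exact (h1.pd_iterate i m).differentiableAt)
    rwa [h2] at h3

/-- The Riemann-Liouville operators in `x_i` commute with `∂/∂x_j`. Analyticity on the segment is
enough: the Taylor series need not reach the terminal at neighbouring points. -/
theorem pd_prl_eq (hij : i ≠ j) (hax : a < x i)
    (hu : ∀ s ∈ Icc a (x i), AnalyticAt ℝ u (Function.update x i s)) (q : ℝ) :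
    pd j (prl q a i u) x = prl q a i (pd j u) x := by
  have he := bracket_sub_gt q
  have hH : ∀ s ∈ Icc a (x i), AnalyticAt ℝ
      (fun z : ℝ × ℝ => u (Function.update (Function.update x j z.1) i z.2)) (x j, s) := by
    intro s hs
    refine analyticAt_update_update hij ?_
    rw [Function.update_eq_self]; exact hu s hs
  have hev : ∀ᶠ y in 𝓝 (x j), prl q a i u (Function.update x j y)
      = 1 / Real.Gamma (1 + bracket q - q) * ∑ m ∈ Finset.range ((bracket q + 1).toNat + 1),
        ((bracket q + 1).toNat.choose m : ℝ)
        * iteratedDeriv m (fun s => (s - a) ^ ((bracket q : ℝ) - q + 1)) (x i)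
        * rescaledIntegral ((bracket q : ℝ) - q) a
          (fun s => u (Function.update (Function.update x j y) i s))
          ((bracket q + 1).toNat - m) (x i) := by
    filter_upwards [eventually_forall_Icc_analyticAt hH] with y hy
    rw [prl, Function.update_of_ne hij, rl, iteratedDeriv_integral_kernel he hax]
    intro s hs
    have h2 : AnalyticAt ℝ (fun s : ℝ => (y, s)) s := by fun_prop
    exact AnalyticAt.fun_comp (f := fun s : ℝ => (y, s)) (hy s hs) h2
  rw [pd, Filter.EventuallyEq.deriv_eq hev, prl, rl, iteratedDeriv_integral_kernel he hax
    fun s hs => AnalyticAt.comp_update ((hu s hs).pd j)]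
  refine (HasDerivAt.const_mul _ (HasDerivAt.fun_sum fun m _ => ?_)).deriv
  exact (hasDerivAt_rescaledIntegral_parameter he hij hax hu _).const_mul _

end Parameter

/-! ### Derivatives of a composite function, in Osler's form -/

lemma analyticAt_iteratedDeriv_snd {E : Type*} [NormedAddCommGroup E] [NormedSpace ℝ E]
    {H : E × ℝ → ℝ} {z : E × ℝ} (h : AnalyticAt ℝ H z) (k : ℕ) :
    AnalyticAt ℝ (fun z : E × ℝ => iteratedDeriv k (fun w => H (z.1, w)) z.2) z := by
  induction k with
  | zero => simpa using h
  | succ k ih =>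
    have hev : (fun z : E × ℝ => iteratedDeriv (k + 1) (fun w => H (z.1, w)) z.2) =ᶠ[𝓝 z]
        fun y => fderiv ℝ (fun z : E × ℝ => iteratedDeriv k (fun w => H (z.1, w)) z.2) y (0, 1) := by
      filter_upwards [ih.eventually_analyticAt] with y hy
      rw [iteratedDeriv_succ]
      exact (hy.differentiableAt.hasFDerivAt.comp_hasDerivAt (f := fun w : ℝ => (y.1, w)) y.2
        ((hasDerivAt_const y.2 y.1).prodMk (hasDerivAt_id y.2))).deriv
    refine AnalyticAt.congr ?_ hev.symm
    exact (ContinuousLinearMap.apply ℝ ℝ ((0, 1) : E × ℝ)).analyticAt _ |>.comp ih.fderiv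

lemma iteratedDeriv_eq_zero_of_isBigO {E : ℝ → ℝ} {t : ℝ} (h : AnalyticAt ℝ E t) {m : ℕ}
    (hO : E =O[𝓝 t] fun s => (s - t) ^ m) {i : ℕ} (hi : i < m) : iteratedDeriv i E t = 0 := by
  refine (natCast_le_analyticOrderAt_iff_iteratedDeriv_eq_zero h).1 ?_ i hi
  by_contra hlt
  rw [not_le] at hlt
  obtain ⟨k, hk⟩ := ENat.ne_top_iff_exists.1 (ne_top_of_lt hlt)
  rw [← hk] at hlt
  have hkm : k < m := by exact_mod_cast hlt
  obtain ⟨g, hg, hg0, hE⟩ := (h.analyticOrderAt_eq_natCast).1 hk.symm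
  obtain ⟨C, hC⟩ := hO.bound
  refine hg0 ?_
  have h0 : Tendsto g (𝓝[≠] t) (𝓝 0) := by
    refine squeeze_zero_norm' (a := fun s => C * ‖s - t‖ ^ (m - k)) ?_ ?_
    · filter_upwards [hC.filter_mono nhdsWithin_le_nhds, hE.filter_mono nhdsWithin_le_nhds,
        self_mem_nhdsWithin] with s h1 h2 h3
      have h3' : 0 < ‖s - t‖ := norm_pos_iff.2 (sub_ne_zero.2 h3)
      rw [h2, norm_smul, norm_pow, norm_pow] at h1
      have e : ‖s - t‖ ^ m = ‖s - t‖ ^ k * ‖s - t‖ ^ (m - k) := by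
        rw [← pow_add, Nat.add_sub_cancel' hkm.le]
      rw [e, mul_left_comm] at h1
      exact le_of_mul_le_mul_left h1 (by positivity)
    · have hc : Continuous fun s : ℝ => C * ‖s - t‖ ^ (m - k) := by fun_prop
      have := hc.tendsto t
      simp only [sub_self, norm_zero, zero_pow (Nat.sub_ne_zero_of_lt hkm), mul_zero] at this
      exact this.mono_left nhdsWithin_le_nhds
  exact tendsto_nhds_unique (hg.continuousAt.tendsto.mono_left nhdsWithin_le_nhds) h0

/-- Taylor's formula in one of two variables, with a remainder that is uniform in the other one. -/
lemma exists_taylor_snd_bound {H : ℝ × ℝ → ℝ} {t v₀ : ℝ} (hH : AnalyticAt ℝ H (t, v₀)) (N : ℕ) :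
    ∃ B : ℝ, ∀ᶠ z in 𝓝 (t, v₀), |H z - ∑ k ∈ Finset.range (N + 1),
      iteratedDeriv k (fun w => H (z.1, w)) v₀ * (z.2 - v₀) ^ k / k.factorial|
        ≤ B * |z.2 - v₀| ^ (N + 1) := by
  set K := fun z : ℝ × ℝ => iteratedDeriv (N + 1) (fun w => H (z.1, w)) z.2 with hK
  have hKc : ContinuousAt K (t, v₀) := (analyticAt_iteratedDeriv_snd hH (N + 1)).continuousAt
  obtain ⟨ε, hε, hball⟩ := Metric.eventually_nhds_iff_ball.1 (hH.eventually_analyticAt.and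
    (hKc.norm.eventually_lt continuousAt_const (lt_add_one ‖K (t, v₀)‖)))
  refine ⟨(‖K (t, v₀)‖ + 1) / (N + 1).factorial, ?_⟩
  filter_upwards [Metric.ball_mem_nhds _ hε] with z hz
  obtain ⟨s, w⟩ := z
  rw [← ball_prod_same, mem_prod] at hz
  have hmem : ∀ w' ∈ uIcc v₀ w, (s, w') ∈ Metric.ball (t, v₀) ε := by
    intro w' hw'
    rw [← ball_prod_same]
    exact ⟨hz.1, (convex_ball v₀ ε).ordConnected.uIcc_subset (Metric.mem_ball_self hε) hz.2 hw'⟩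
  have han : ∀ w' ∈ uIcc v₀ w, AnalyticAt ℝ (fun w => H (s, w)) w' := fun w' hw' =>
    AnalyticAt.fun_comp (f := fun w => (s, w)) (hball _ (hmem w' hw')).1
      (analyticAt_const.prod analyticAt_id)
  rcases eq_or_ne v₀ w with rfl | hne
  · rw [Finset.sum_range_succ']
    simp
  have hU : UniqueDiffOn ℝ (uIcc v₀ w) := uniqueDiffOn_Icc (by simpa [eq_comm] using hne)
  have hD : ∀ k, ∀ w' ∈ uIcc v₀ w, iteratedDerivWithin k (fun w => H (s, w)) (uIcc v₀ w) w'
      = iteratedDeriv k (fun w => H (s, w)) w' := fun k w' hw' =>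
    iteratedDerivWithin_eq_iteratedDeriv hU ((han w' hw').contDiffAt) hw'
  obtain ⟨x', hx', hx⟩ := taylor_mean_remainder_lagrange (f := fun w => H (s, w)) (n := N) hne
    (fun w' hw' => (han w' hw').contDiffAt.contDiffWithinAt)
    (fun w' hw' => by
      have hsub := uIoo_subset_uIcc_self hw'
      refine DifferentiableWithinAt.congr (f := iteratedDeriv N fun w => H (s, w)) ?_
        (fun y hy => hD N y (uIoo_subset_uIcc_self hy)) (hD N w' hsub)
      exact (analyticAt_iteratedDeriv (han w' hsub) N).differentiableAt.differentiableWithinAt)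
  rw [taylor_within_apply, hD _ _ (uIoo_subset_uIcc_self hx')] at hx
  have hsum : ∑ k ∈ Finset.range (N + 1), ((k.factorial : ℝ)⁻¹ * (w - v₀) ^ k) •
      iteratedDerivWithin k (fun w => H (s, w)) (uIcc v₀ w) v₀
      = ∑ k ∈ Finset.range (N + 1),
        iteratedDeriv k (fun w => H (s, w)) v₀ * (w - v₀) ^ k / k.factorial := by
    refine Finset.sum_congr rfl fun k _ => ?_
    rw [hD _ _ left_mem_uIcc, smul_eq_mul]
    ring
  rw [hsum] at hx
  simp only
  rw [hx, abs_div, abs_mul, abs_pow, Nat.abs_cast, div_mul_eq_mul_div]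
  gcongr
  exact (hball _ (hmem x' (uIoo_subset_uIcc_self hx'))).2.le

section Osler

variable {H : ℝ × ℝ → ℝ} {v : ℝ → ℝ} {t : ℝ}

lemma iteratedDeriv_sub_pow_eq_zero (hv : AnalyticAt ℝ v t) {m k : ℕ} (h : m < k) :
    iteratedDeriv m (fun s => (v s - v t) ^ k) t = 0 := by
  refine iteratedDeriv_eq_zero_of_isBigO ((hv.sub analyticAt_const).pow k) ?_ h
  exact hv.differentiableAt.isBigO_sub.pow k

lemma analyticAt_iteratedDeriv_snd_left (hH : AnalyticAt ℝ H (t, v t)) (k : ℕ) :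
    AnalyticAt ℝ (fun s => iteratedDeriv k (fun w => H (s, w)) (v t)) t :=
  AnalyticAt.fun_comp (f := fun s => (s, v t)) (analyticAt_iteratedDeriv_snd hH k)
    (analyticAt_id.prod analyticAt_const)

/-- Only the first `N` Taylor terms in the dependent variable contribute to the derivatives of
order at most `N`. -/
lemma iteratedDeriv_comp_eq_sum (hH : AnalyticAt ℝ H (t, v t)) (hv : AnalyticAt ℝ v t) {n N : ℕ}
    (hn : n ≤ N) :
    iteratedDeriv n (fun s => H (s, v s)) t = ∑ k ∈ Finset.range (N + 1), ∑ m ∈ Finset.range (n + 1),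
      (n.choose m : ℝ) / k.factorial * iteratedDeriv m (fun s => (v s - v t) ^ k) t
        * iteratedDeriv (n - m) (fun s => iteratedDeriv k (fun w => H (s, w)) (v t)) t := by
  have hcomp : AnalyticAt ℝ (fun s => H (s, v s)) t :=
    AnalyticAt.fun_comp (f := fun s => (s, v s)) hH (analyticAt_id.prod hv)
  have hpow : ∀ k : ℕ, AnalyticAt ℝ (fun s => (v s - v t) ^ k) t := fun k =>
    (hv.sub analyticAt_const).pow k
  have hk := fun k => analyticAt_iteratedDeriv_snd_left hH k
  have hterm : ∀ k : ℕ, AnalyticAt ℝ (fun s => (k.factorial : ℝ)⁻¹ * ((v s - v t) ^ k *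
      iteratedDeriv k (fun w => H (s, w)) (v t))) t := fun k =>
    analyticAt_const.mul ((hpow k).mul (hk k))
  have hsum : AnalyticAt ℝ (fun s => ∑ k ∈ Finset.range (N + 1), (k.factorial : ℝ)⁻¹ *
      ((v s - v t) ^ k * iteratedDeriv k (fun w => H (s, w)) (v t))) t :=
    Finset.analyticAt_fun_sum _ fun k _ => hterm k
  obtain ⟨B, hB⟩ := exists_taylor_snd_bound hH N
  have hO : (fun s => H (s, v s) - ∑ k ∈ Finset.range (N + 1), (k.factorial : ℝ)⁻¹ *
      ((v s - v t) ^ k * iteratedDeriv k (fun w => H (s, w)) (v t)))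
      =O[𝓝 t] fun s => (s - t) ^ (N + 1) := by
    have h1 : (fun s => H (s, v s) - ∑ k ∈ Finset.range (N + 1), (k.factorial : ℝ)⁻¹ *
        ((v s - v t) ^ k * iteratedDeriv k (fun w => H (s, w)) (v t)))
        =O[𝓝 t] fun s => (v s - v t) ^ (N + 1) := by
      refine Asymptotics.IsBigO.of_bound B ?_
      have ht : Tendsto (fun s => (s, v s)) (𝓝 t) (𝓝 (t, v t)) :=
        continuousAt_id.prodMk hv.continuousAt
      filter_upwards [ht.eventually hB] with s hs
      rw [norm_pow, Real.norm_eq_abs, Real.norm_eq_abs]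
      refine le_trans (le_of_eq ?_) hs
      congr 2
      refine Finset.sum_congr rfl fun k _ => ?_
      ring
    exact h1.trans (hv.differentiableAt.isBigO_sub.pow (N + 1))
  have hzero := iteratedDeriv_eq_zero_of_isBigO (hcomp.sub hsum) hO (Nat.lt_succ_of_le hn)
  rw [iteratedDeriv_sub hcomp.contDiffAt hsum.contDiffAt, sub_eq_zero] at hzero
  rw [hzero, iteratedDeriv_fun_sum fun k _ => (hterm k).contDiffAt]
  refine Finset.sum_congr rfl fun k _ => ?_
  rw [iteratedDeriv_const_mul_field, iteratedDeriv_fun_mul (hpow k).contDiffAt (hk k).contDiffAt,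
    Finset.mul_sum]
  refine Finset.sum_congr rfl fun m _ => ?_
  ring

lemma iteratedDeriv_sub_pow (hv : AnalyticAt ℝ v t) {m : ℕ} (hm : m ≠ 0) (k : ℕ) :
    iteratedDeriv m (fun s => (v s - v t) ^ k) t = ∑ r ∈ Finset.range k,
      (k.choose r : ℝ) * (-v t) ^ r * iteratedDeriv m (fun s => v s ^ (k - r)) t := by
  have h1 : (fun s => (v s - v t) ^ k) = fun s => ∑ r ∈ Finset.range (k + 1),
      ((k.choose r : ℝ) * (-v t) ^ r) * v s ^ (k - r) := by
    funext s
    rw [sub_eq_add_neg, add_comm, add_pow]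
    refine Finset.sum_congr rfl fun r _ => ?_
    ring
  have h2 : ∀ r ∈ Finset.range (k + 1), ContDiffAt ℝ m
      (fun s => ((k.choose r : ℝ) * (-v t) ^ r) * v s ^ (k - r)) t := fun r _ =>
    (analyticAt_const.mul (hv.fun_pow (k - r))).contDiffAt
  rw [h1, iteratedDeriv_fun_sum h2, Finset.sum_range_succ]
  simp only [iteratedDeriv_const_mul_field]
  simp [iteratedDeriv_const, hm]

lemma leibniz_comm (A B : ℕ → ℝ) (n : ℕ) : leibniz A B n = leibniz B A n := by
  rw [leibniz, leibniz, ← Finset.sum_range_reflect]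
  refine Finset.sum_congr rfl fun k hk => ?_
  have hk' : k ≤ n := Nat.lt_succ_iff.1 (Finset.mem_range.1 hk)
  have e : n + 1 - 1 - k = n - k := by lia
  rw [e, Nat.choose_symm hk', Nat.sub_sub_self hk']
  ring

/-- The chain rule of higher order for `s ↦ H (s, v s)`: the terms of order `0` and `1` in the
dependent variable are separated from those of order at least `2`. -/
theorem iteratedDeriv_comp_eq_osler (hH : AnalyticAt ℝ H (t, v t)) (hv : AnalyticAt ℝ v t) (n : ℕ) :
    iteratedDeriv n (fun s => H (s, v s)) t
      = iteratedDeriv n (fun s => H (s, v t)) t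
      + (leibniz (fun n => iteratedDeriv n (fun s => deriv (fun w => H (s, w)) (v t)) t)
          (fun n => iteratedDeriv n v t) n
        - v t * iteratedDeriv n (fun s => deriv (fun w => H (s, w)) (v t)) t)
      + ∑ m ∈ Finset.Icc 2 n, ∑ k ∈ Finset.Icc 2 m, ∑ r ∈ Finset.range k,
        (n.choose m : ℝ) * (k.choose r : ℝ) * (-v t) ^ r / k.factorial
        * iteratedDeriv m (fun s => v s ^ (k - r)) t
        * iteratedDeriv (n - m) (fun s => iteratedDeriv k (fun w => H (s, w)) (v t)) t := by
  rw [iteratedDeriv_comp_eq_sum hH hv (Nat.le_succ n),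
    ← Finset.sum_range_add_sum_Ico _ (Nat.le_add_left 2 n), Finset.sum_range_succ,
    Finset.sum_range_one]
  congr 1
  · congr 1
    · rw [Finset.sum_range_succ', Finset.sum_eq_zero]
      · simp
      · intro m _
        simp [iteratedDeriv_const]
    · rw [leibniz_comm, leibniz, Finset.sum_range_succ', Finset.sum_range_succ']
      simp only [pow_one, iteratedDeriv_one, iteratedDeriv_zero, sub_self, Nat.factorial_one,
        Nat.cast_one, div_one, mul_zero, zero_mul, add_zero, Nat.choose_zero_right, one_mul,
        Nat.sub_zero, add_sub_cancel_right]
      refine Finset.sum_congr rfl fun m _ => ?_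
      rw [iteratedDeriv_fun_sub hv.contDiffAt contDiffAt_const]
      simp [iteratedDeriv_const]
  · rw [Finset.sum_comm]
    have hz : ∀ m k : ℕ, m < k →
        (n.choose m : ℝ) / k.factorial * iteratedDeriv m (fun s => (v s - v t) ^ k) t
        * iteratedDeriv (n - m) (fun s => iteratedDeriv k (fun w => H (s, w)) (v t)) t = 0 := by
      intro m k h
      rw [iteratedDeriv_sub_pow_eq_zero hv h]; simp
    symm
    rw [← Finset.sum_subset (s₁ := Finset.Icc 2 n)
      (f := fun m => ∑ k ∈ Finset.Ico 2 (n + 2), (n.choose m : ℝ) / k.factorial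
        * iteratedDeriv m (fun s => (v s - v t) ^ k) t
        * iteratedDeriv (n - m) (fun s => iteratedDeriv k (fun w => H (s, w)) (v t)) t)]
    · refine Finset.sum_congr rfl fun m hm => ?_
      rw [Finset.mem_Icc] at hm
      rw [← Finset.sum_subset (s₁ := Finset.Icc 2 m) (s₂ := Finset.Ico 2 (n + 2))]
      · refine Finset.sum_congr rfl fun k _ => ?_
        rw [iteratedDeriv_sub_pow hv (by lia), Finset.mul_sum, Finset.sum_mul]
        refine Finset.sum_congr rfl fun r _ => ?_
        ring
      · intro k hk
        rw [Finset.mem_Icc] at hk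
        rw [Finset.mem_Ico]
        lia
      · intro k hk hk'
        rw [Finset.mem_Ico] at hk
        rw [Finset.mem_Icc] at hk'
        exact hz m k (by lia)
    · intro m hm
      rw [Finset.mem_Icc] at hm
      rw [Finset.mem_range]
      lia
    · intro m hm hm'
      rw [Finset.mem_range] at hm
      rw [Finset.mem_Icc] at hm'
      refine Finset.sum_eq_zero fun k hk => ?_
      rw [Finset.mem_Ico] at hk
      exact hz m k (by lia)

end Osler

/-! ### The operators as functions on the jet space -/

lemma prod_eq_mul_of_ne {i j : Fin 2} (hij : i ≠ j) (f : Fin 2 → ℝ) : ∏ l, f l = f i * f j := by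
  rw [Fin.prod_univ_two]
  obtain ⟨rfl, rfl⟩ | ⟨rfl, rfl⟩ : (i = 0 ∧ j = 1) ∨ (i = 1 ∧ j = 0) := by lia
  · rfl
  · exact mul_comm _ _

lemma sum_eq_add_of_ne {i j : Fin 2} (hij : i ≠ j) (f : Fin 2 → ℝ) : ∑ l, f l = f i + f j := by
  rw [Fin.sum_univ_two]
  obtain ⟨rfl, rfl⟩ | ⟨rfl, rfl⟩ : (i = 0 ∧ j = 1) ∨ (i = 1 ∧ j = 0) := by lia
  · rfl
  · exact add_comm _ _

lemma mpd_single (i : Fin 2) (n : ℕ) (f : Base → ℝ) : mpd (Pi.single i n) f = (pd i)^[n] f := by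
  obtain rfl | rfl : i = 0 ∨ i = 1 := by lia
  · simp [mpd]
  · simp [mpd]

/-- The coefficient of `u^σ` in `rlJet`. -/
def rlJetCoeff (p a : Fin 2 → ℝ) (y : Base) (σ : Fin 2 → ℕ) : ℝ :=
  ∏ i, Ring.choose (p i) (σ i) * (y i - a i) ^ ((σ i : ℝ) - p i) /
    Real.Gamma ((σ i : ℝ) - p i + 1)

section Jet

variable {i j : Fin 2} (p : ℝ) (a : Fin 2 → ℝ)

lemma rlJetCoeff_single (hij : i ≠ j) (y : Base) (n : ℕ) :
    rlJetCoeff (Pi.single i p) a y (Pi.single i n)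
      = rlCoeff p n * (y i - a i) ^ ((n : ℝ) - p) := by
  rw [rlJetCoeff, prod_eq_mul_of_ne hij]
  simp [hij.symm, rlCoeff]
  ring

lemma rlJetCoeff_eq_zero (hij : i ≠ j) (y : Base) {σ : Fin 2 → ℕ}
    (hσ : σ ∉ range fun n : ℕ => (Pi.single i n : Fin 2 → ℕ)) : rlJetCoeff (Pi.single i p) a y σ = 0 := by
  have hj : σ j ≠ 0 := by
    intro h
    refine hσ ⟨σ i, ?_⟩
    funext l
    rcases eq_or_ne l i with rfl | hl
    · simp
    · have : l = j := by lia
      subst this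
      simp [hl, h]
  rw [rlJetCoeff, prod_eq_mul_of_ne hij, Pi.single_eq_of_ne hij.symm,
    Ring.choose_zero_pos ℝ (Nat.pos_of_ne_zero hj)]
  simp

lemma single_injective (i : Fin 2) : Function.Injective fun n : ℕ => (Pi.single i n : Fin 2 → ℕ) :=
  Pi.single_injective (M := fun _ => ℕ) i

lemma rlJet_single (hij : i ≠ j) (z : Jet) : rlJet (Pi.single i p) a z
    = ∑' n : ℕ, rlCoeff p n * (z.1 i - a i) ^ ((n : ℝ) - p) * z.2 (Pi.single i n) := by
  have h : rlJet (Pi.single i p) a z = ∑' σ, rlJetCoeff (Pi.single i p) a z.1 σ * z.2 σ := rfl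
  rw [h, ← (single_injective i).tsum_eq]
  · exact tsum_congr fun n => by rw [rlJetCoeff_single p a hij]
  · intro σ hσ
    by_contra hn
    exact hσ (by simp only [rlJetCoeff_eq_zero p a hij z.1 hn, zero_mul])

lemma rlJet_jet (hij : i ≠ j) (u : Base → ℝ) (x : Base) : rlJet (Pi.single i p) a (jet u x)
    = rlSeries p (x i - a i) (fun n => (pd i)^[n] u x) := by
  rw [rlJet_single p a hij, rlSeries]
  simp only [jet, mpd_single]

/-- A convergent series that is linear in the fibre coordinates has its coefficients as partial
derivatives. -/
lemma hasDerivAt_rlJet_coord (x : Base) (ζ : (Fin 2 → ℕ) → ℝ) (p : Fin 2 → ℝ)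
    (hs : Summable fun σ => rlJetCoeff p a x σ * ζ σ) (σ : Fin 2 → ℕ) (w₀ : ℝ) :
    HasDerivAt (fun w => rlJet p a (x, Function.update ζ σ w)) (rlJetCoeff p a x σ) w₀ := by
  have h : (fun w => rlJet p a (x, Function.update ζ σ w)) = fun w =>
      rlJetCoeff p a x σ * w - rlJetCoeff p a x σ * ζ σ
        + ∑' σ, rlJetCoeff p a x σ * ζ σ := by
    funext w
    have h1 := hs.hasSum.update σ (rlJetCoeff p a x σ * w)
    have h2 : Function.update (fun σ => rlJetCoeff p a x σ * ζ σ) σ (rlJetCoeff p a x σ * w)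
        = fun σ' => rlJetCoeff p a x σ' * Function.update ζ σ w σ' := by
      funext σ'
      rcases eq_or_ne σ' σ with rfl | hne
      · simp
      · simp [hne]
    rw [h2] at h1
    exact h1.tsum_eq
  rw [h]
  simpa using (((hasDerivAt_id' w₀).const_mul (rlJetCoeff p a x σ)).sub_const
    (rlJetCoeff p a x σ * ζ σ)).add_const (∑' σ, rlJetCoeff p a x σ * ζ σ)

lemma summable_rlJetCoeff_mul (hij : i ≠ j) {u : Base → ℝ} {x : Base} (hx : a i < x i)
    (hR : Reaches (x i - a i) fun n => (pd i)^[n] u x) :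
    Summable fun σ => rlJetCoeff (Pi.single i p) a x σ * mpd σ u x := by
  rw [← (single_injective i).summable_iff]
  · refine (summable_rlSeries (sub_pos.2 hx) p hR).congr fun n => ?_
    rw [Function.comp_apply, rlJetCoeff_single p a hij, mpd_single]
  · intro σ hσ
    rw [rlJetCoeff_eq_zero p a hij x hσ, zero_mul]

end Jet

/-- The explicit dependence of the series on the distance to the terminal may be differentiated
term by term. -/
lemma hasDerivAt_rlSeries_explicit {τ : ℝ} (hτ : 0 < τ) (p : ℝ) {A : ℕ → ℝ} (hA : Reaches τ A) :
    HasDerivAt (fun s => ∑' n : ℕ, rlCoeff p n * s ^ ((n : ℝ) - p) * A n)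
      (∑' n : ℕ, rlCoeff p n * (((n : ℝ) - p) * τ ^ ((n : ℝ) - p - 1)) * A n) τ := by
  obtain ⟨C, ρ, hρ, hb⟩ := id hA
  have hC : 0 ≤ C := by simpa using (abs_nonneg _).trans (hb 0)
  set b := (τ + ρ) / 2 with hbdef
  have hτb : τ < b := by linarith
  have hb0 : 0 < b := hτ.trans hτb
  have hρ0 : 0 < ρ := hτ.trans hρ
  have hmem : τ ∈ Ioo (τ / 2) b := ⟨by linarith, hτb⟩
  set N := (τ / 2) ^ (-p - 1) + b ^ (-p - 1) with hN
  have hN1 : 0 ≤ (τ / 2) ^ (-p - 1) := Real.rpow_nonneg (by linarith) _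
  have hN2 : 0 ≤ b ^ (-p - 1) := Real.rpow_nonneg hb0.le _
  refine hasDerivAt_tsum_of_isPreconnected (𝕜 := ℝ) (t := Ioo (τ / 2) b) (y₀ := τ)
    (g := fun (n : ℕ) s => rlCoeff p n * s ^ ((n : ℝ) - p) * A n)
    (g' := fun (n : ℕ) s => rlCoeff p n * (((n : ℝ) - p) * s ^ ((n : ℝ) - p - 1)) * A n)
    (u := fun n => |1 / Real.Gamma (-p)| * N * C * (b / ρ) ^ n)
    ((summable_geometric_of_lt_one (by positivity)
      (by rw [div_lt_one hρ0]; linarith)).mul_left _)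
    isOpen_Ioo isPreconnected_Ioo ?_ ?_ hmem (summable_rlSeries hτ p hA) hmem
  · intro n s hs
    have hs0 : 0 < s := by linarith [hs.1]
    exact ((Real.hasDerivAt_rpow_const (Or.inl hs0.ne')).const_mul _).mul_const _
  · intro n s hs
    have hs0 : 0 < s := by linarith [hs.1]
    have hsN : s ^ (-p - 1) ≤ N := by
      rcases le_total 0 (-p - 1) with he | he
      · have := Real.rpow_le_rpow hs0.le hs.2.le he
        linarith
      · have := Real.rpow_le_rpow_of_nonpos (by linarith) hs.1.le he
        linarith
    have hpos : 0 ≤ s ^ (-p - 1) := Real.rpow_nonneg hs0.le _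
    have hpow : s ^ n ≤ b ^ n := by gcongr; exact hs.2.le
    have e1 : s ^ ((n : ℝ) - p - 1) = s ^ n * s ^ (-p - 1) := by
      rw [sub_sub, rpow_natCast_sub hs0]; congr 2; ring
    rw [Real.norm_eq_abs, ← mul_assoc, rlCoeff_mul_sub_eq, e1, abs_mul, abs_mul, abs_div, abs_mul,
      abs_pow, abs_neg, abs_one, one_pow, Nat.abs_cast,
      abs_of_nonneg (by positivity : 0 ≤ s ^ n * s ^ (-p - 1))]
    calc 1 / (n.factorial * |Real.Gamma (-p)|) * (s ^ n * s ^ (-p - 1)) * |A n|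
        ≤ 1 / (n.factorial * |Real.Gamma (-p)|) * (b ^ n * N) * (C * n.factorial / ρ ^ n) := by
          gcongr
          exact hb n
      _ = |1 / Real.Gamma (-p)| * N * C * (b / ρ) ^ n := by
          rw [abs_div, abs_one, div_pow b, one_div, mul_inv]
          clear_value b
          have : (n.factorial : ℝ) ≠ 0 := by positivity
          field_simp

/-! ### Evaluation of the operators and of the terms of the formula -/

lemma ud_iterate_eq (k : ℕ) (φ : Base × ℝ → ℝ) (y : Base) (w : ℝ) :
    ud^[k] φ (y, w) = iteratedDeriv k (fun w => φ (y, w)) w := by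
  induction k generalizing w with
  | zero => simp
  | succ k ih =>
    rw [Function.iterate_succ_apply', iteratedDeriv_succ, ud]
    exact congrArg (fun h : ℝ → ℝ => deriv h w) (funext ih)

lemma _root_.AnalyticAt.ud {φ : Base × ℝ → ℝ} {z : Base × ℝ} (h : AnalyticAt ℝ φ z) :
    AnalyticAt ℝ (ud φ) z := by
  have := analyticAt_iteratedDeriv_snd h 1
  simp only [iteratedDeriv_one] at this
  exact this

section Line

variable {f g : Base → ℝ} {x : Base} {i : Fin 2}

lemma analyticAt_line (hf : AnalyticAt ℝ f x) :
    AnalyticAt ℝ (fun s => f (Function.update x i s)) (x i) :=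
  AnalyticAt.comp_update (by rwa [Function.update_eq_self])

lemma pd_iterate_mul (hf : AnalyticAt ℝ f x) (hg : AnalyticAt ℝ g x) (n : ℕ) :
    (pd i)^[n] (fun y => f y * g y) x
      = leibniz (fun n => (pd i)^[n] f x) (fun n => (pd i)^[n] g x) n := by
  simp only [pd_iterate_eq, leibniz]
  exact iteratedDeriv_fun_mul (analyticAt_line hf).contDiffAt (analyticAt_line hg).contDiffAt

lemma pd_iterate_sub (hf : AnalyticAt ℝ f x) (hg : AnalyticAt ℝ g x) (n : ℕ) :
    (pd i)^[n] (fun y => f y - g y) x = (pd i)^[n] f x - (pd i)^[n] g x := by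
  simp only [pd_iterate_eq]
  exact iteratedDeriv_fun_sub (analyticAt_line hf).contDiffAt (analyticAt_line hg).contDiffAt

lemma pd_iterate_add (hf : AnalyticAt ℝ f x) (hg : AnalyticAt ℝ g x) (n : ℕ) :
    (pd i)^[n] (fun y => f y + g y) x = (pd i)^[n] f x + (pd i)^[n] g x := by
  simp only [pd_iterate_eq]
  exact iteratedDeriv_fun_add (analyticAt_line hf).contDiffAt (analyticAt_line hg).contDiffAt

lemma prl_eq_rlSeries {a : ℝ} (hax : a < x i)
    (hf : ∀ s ∈ Icc a (x i), AnalyticAt ℝ f (Function.update x i s))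
    (hR : TaylorReaches a i f x) (q : ℝ) :
    prl q a i f x = rlSeries q (x i - a) (fun n => (pd i)^[n] f x) := by
  have hR' : Reaches (x i - a) fun n => (pd i)^[n] f x := hR
  simp only [pd_iterate_eq] at hR' ⊢
  exact rl_eq_rlSeries q hax (fun s hs => AnalyticAt.comp_update (hf s hs)) hR'

/-- The Taylor series at `x` sums to the value at the terminal. -/
lemma tsum_taylor_eq {a : ℝ} (hax : a < x i)
    (hf : ∀ s ∈ Icc a (x i), AnalyticAt ℝ f (Function.update x i s))
    (hR : TaylorReaches a i f x) :
    ∑' n : ℕ, (-(x i - a)) ^ n * (pd i)^[n] f x / n.factorial = f (Function.update x i a) := by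
  have hR' : Reaches (x i - a) fun n => (pd i)^[n] f x := hR
  simp only [pd_iterate_eq] at hR' ⊢
  obtain ⟨g, P, ρ, hρ, hg, heqOn, heq⟩ := exists_hasFPowerSeriesOnBall hax
    (fun s hs => AnalyticAt.comp_update (hf s hs)) hR'
  have h := hg.hasSum_iteratedDeriv_of_mem (s := x i) (r := a)
    (by rw [sub_self, abs_zero, zero_add, abs_sub_comm, abs_of_pos (sub_pos.2 hax)]; exact hρ)
  rw [← heqOn (left_mem_Icc.2 hax.le)] at h
  refine (h.of_eq (fun n => ?_) rfl).tsum_eq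
  rw [heq.iteratedDeriv_eq n, neg_sub]
  ring

end Line

lemma oslerTerm_eq {φ : Base × ℝ → ℝ} {u : Base → ℝ} {x : Base} (p : ℝ) (a : Fin 2 → ℝ) (i : Fin 2)
    (hφ : AnalyticAt ℝ φ (x, u x)) (hu : AnalyticAt ℝ u x) (n : ℕ) :
    oslerTerm φ u p a i x n = rlCoeff p n * (x i - a i) ^ ((n : ℝ) - p)
      * ((pd i)^[n] (fun y => φ (y, u y)) x - (pd i)^[n] (fun y => φ (y, u x)) x
        - (leibniz (fun n => (pd i)^[n] (fun y => ud φ (y, u x)) x) (fun n => (pd i)^[n] u x) n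
          - u x * (pd i)^[n] (fun y => ud φ (y, u x)) x)) := by
  have hH : AnalyticAt ℝ (fun z : ℝ × ℝ => φ (Function.update x i z.1, z.2))
      (x i, (fun s => u (Function.update x i s)) (x i)) := by
    refine AnalyticAt.fun_comp (g := φ)
      (f := fun z : ℝ × ℝ => (Function.update x i z.1, z.2)) (by simpa using hφ) ?_
    refine AnalyticAt.prod ?_ analyticAt_snd
    rw [analyticAt_pi_iff]
    intro l
    rcases eq_or_ne l i with rfl | hli
    · simpa using analyticAt_fst
    · simpa [hli] using analyticAt_const
  have key := iteratedDeriv_comp_eq_osler hH (analyticAt_line hu) n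
  simp only [Function.update_eq_self] at key
  simp only [oslerTerm, pd_iterate_eq, ud_iterate_eq, ud]
  have cancel : ∀ A B C : ℝ, A + B + C - A - B = C := fun A B C => by ring
  rw [key, rlCoeff, cancel]
  simp only [Finset.mul_sum]
  refine Finset.sum_congr rfl fun m _ => Finset.sum_congr rfl fun k _ =>
    Finset.sum_congr rfl fun r _ => ?_
  rw [show (n : ℝ) + 1 - p = n - p + 1 by ring]
  ring

/-! ### The prolongation formula at admissible points -/

section Prolongation

variable {ξ : Fin 2 → Base × ℝ → ℝ} {φ : Base × ℝ → ℝ} {u : Base → ℝ} {x : Base} {i j : Fin 2}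

/-- The prolonged coefficients of order `n` in `x_i` alone, after expanding the total derivatives of
the products by the Leibniz rule. -/
lemma prolCoeff_single (hij : i ≠ j) (hu : AnalyticAt ℝ u x)
    (hφ : AnalyticAt ℝ (fun y => φ (y, u y)) x)
    (hξ : ∀ l, AnalyticAt ℝ (fun y => ξ l (y, u y)) x) (n : ℕ) :
    prolCoeff ξ φ u (Pi.single i n) x = (pd i)^[n] (fun y => φ (y, u y)) x
      - leibniz (fun n => (pd i)^[n] (fun y => ξ i (y, u y)) x) (fun n => (pd i)^[n + 1] u x) n
      - leibniz (fun n => (pd i)^[n] (fun y => ξ j (y, u y)) x) (fun n => (pd i)^[n] (pd j u) x) n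
      + ξ i (x, u x) * (pd i)^[n + 1] u x + ξ j (x, u x) * (pd i)^[n] (pd j u) x := by
  simp only [prolCoeff, mpd_single, sum_eq_add_of_ne hij]
  rw [pd_iterate_sub hφ (((hξ i).fun_mul (hu.pd i)).fun_add ((hξ j).fun_mul (hu.pd j))),
    pd_iterate_add ((hξ i).fun_mul (hu.pd i)) ((hξ j).fun_mul (hu.pd j)),
    pd_iterate_mul (hξ i) (hu.pd i), pd_iterate_mul (hξ j) (hu.pd j),
    (pd_iterate_comm i j n hu).eq_of_nhds]
  have h1 : ∀ k, (pd i)^[k] (pd i u) x = (pd i)^[k + 1] u x := fun k => rfl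
  have h2 : pd i ((pd i)^[n] u) x = (pd i)^[n + 1] u x := by rw [Function.iterate_succ_apply']
  simp only [h1, h2]
  ring

theorem Admissible.prolongationFormula {D : Set Base} {M : Set (Base × ℝ)} {a : Fin 2 → ℝ}
    (hξ : ∀ l, AnalyticOnNhd ℝ (ξ l) M) (hφ : AnalyticOnNhd ℝ φ M) (hu : AnalyticOnNhd ℝ u D)
    (hgraph : ∀ x ∈ D, (x, u x) ∈ M) (hij : i ≠ j)
    (hinv : ∀ z ∈ M, z.1 i = a i → ξ i z = 0) (h : Admissible D M ξ φ u a i j x) (p : ℝ) :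
    ProlongationFormula ξ φ u p a i j x := by
  have hτ : 0 < x i - a i := sub_pos.2 h.above
  set τ := x i - a i with hτdef
  -- Analyticity at the point and along the segment.
  have hxD : x ∈ D := by
    have := h.segment (x i) (right_mem_Icc.2 h.above.le)
    rwa [Function.update_eq_self] at this
  have hgr : ∀ y ∈ D, AnalyticAt ℝ (fun y => (y, u y)) y := fun y hy => analyticAt_id.prod (hu y hy)
  have hcomp : ∀ {ψ : Base × ℝ → ℝ}, AnalyticOnNhd ℝ ψ M → ∀ y ∈ D,
      AnalyticAt ℝ (fun y => ψ (y, u y)) y := fun {ψ} hψ y hy =>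
    AnalyticAt.fun_comp (g := ψ) (f := fun y => (y, u y)) (hψ _ (hgraph y hy)) (hgr y hy)
  have hfrozen : ∀ {ψ : Base × ℝ → ℝ}, AnalyticOnNhd ℝ ψ M → ∀ s ∈ Icc (a i) (x i),
      AnalyticAt ℝ (fun y => ψ (y, u x)) (Function.update x i s) := fun {ψ} hψ s hs =>
    AnalyticAt.fun_comp (g := ψ) (f := fun y => (y, u x)) (hψ _ (h.frozen_segment s hs))
      (analyticAt_id.prod analyticAt_const)
  have hus : ∀ s ∈ Icc (a i) (x i), AnalyticAt ℝ u (Function.update x i s) := fun s hs =>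
    hu _ (h.segment s hs)
  -- The sequences of derivatives at `x` in the direction `x_i`.
  set U := fun n => (pd i)^[n] u x with hU
  set V := fun n => (pd i)^[n] (pd j u) x with hV
  set Φ := fun n => (pd i)^[n] (fun y => φ (y, u y)) x with hΦ
  set X := fun n => (pd i)^[n] (fun y => ξ i (y, u y)) x with hX
  set Y := fun n => (pd i)^[n] (fun y => ξ j (y, u y)) x with hY
  set Q := fun n => (pd i)^[n] (fun y => φ (y, u x)) x with hQ
  set G := fun n => (pd i)^[n] (fun y => ud φ (y, u x)) x with hG
  have rU : Reaches τ U := h.taylor_u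
  have rV : Reaches τ V := h.taylor_pd_u
  have rΦ : Reaches τ Φ := h.taylor_phi
  have rX : Reaches τ X := h.taylor_xi i
  have rY : Reaches τ Y := h.taylor_xi j
  have rQ : Reaches τ Q := h.taylor_phi_frozen
  have rG : Reaches τ G := h.taylor_ud_phi_frozen
  have rU' : Reaches τ fun n => U (n + 1) := rU.shift hτ
  -- The operators, as series in these derivatives.
  have opU : ∀ q, prl q (a i) i u x = rlSeries q τ U := fun q =>
    prl_eq_rlSeries h.above hus h.taylor_u q
  have opV : ∀ q, pd j (prl q (a i) i u) x = rlSeries q τ V := fun q => by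
    rw [pd_prl_eq hij h.above hus]
    exact prl_eq_rlSeries h.above (fun s hs => (hus s hs).pd j) h.taylor_pd_u q
  have opQ : prl p (a i) i (fun y => φ (y, u x)) x = rlSeries p τ Q :=
    prl_eq_rlSeries h.above (hfrozen hφ) h.taylor_phi_frozen p
  have opG : prl p (a i) i (fun y => ud φ (y, u x)) x = rlSeries p τ G :=
    prl_eq_rlSeries h.above (hfrozen fun z hz => (hφ z hz).ud) h.taylor_ud_phi_frozen p
  -- The invariance of the terminal.
  have hX0 : ∑' n : ℕ, (-τ) ^ n * X n / n.factorial = 0 := by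
    have hmem : Function.update x i (a i) ∈ D := h.segment _ (left_mem_Icc.2 h.above.le)
    rw [tsum_taylor_eq h.above (fun s hs => hcomp (hξ i) _ (h.segment s hs)) (h.taylor_xi i)]
    exact hinv _ (hgraph _ hmem) (by simp)
  -- The series in the operators of lower order.
  have sG := hasSum_rlSeries_leibniz hτ p rU rG
  have sX := hasSum_transport hτ p rX rU hX0
  have sY := hasSum_rlSeries_leibniz hτ p rV rY
  have sSeries := (hasSum_nat_add_iff' 1).2 <|
    (((sG.sub sX).sub sY).of_eq (g := seriesTerm ξ φ u p a i j x) (fun n => by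
      simp only [seriesTerm, opU, opV]
      ring) rfl)
  -- The remainder of Osler type.
  have sOsler := (hasSum_nat_add_iff' 2).2 <| (((hasSum_rlSeries hτ p rΦ).sub
    (hasSum_rlSeries hτ p rQ)).sub ((hasSum_rlSeries hτ p (rG.leibniz hτ rU)).sub
      ((hasSum_rlSeries hτ p rG).mul_left (u x)))).of_eq (g := oslerTerm φ u p a i x) (fun n => by
      rw [oslerTerm_eq p a i (hφ _ (hgraph x hxD)) (hu x hxD)]
      ring) rfl
  have hosler0 : ∑ n ∈ Finset.range 2, oslerTerm φ u p a i x n = 0 := by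
    simp [Finset.sum_range_succ, oslerTerm]
  rw [hosler0, sub_zero] at sOsler
  rw [Finset.sum_range_one] at sSeries
  have hser0 : seriesTerm ξ φ u p a i j x 0 = (G 0 - p * X 1) * rlSeries p τ U
      - Y 0 * rlSeries p τ V := by
    simp [seriesTerm, opU, opV, hG, hX, hY]
  refine ⟨by rw [rlJet_jet p a hij, opU], sSeries.summable, sOsler.summable, ?_⟩
  -- The partial derivatives of the operator as a function on the jet space.
  set E := ∑' n : ℕ, rlCoeff p n * (((n : ℝ) - p) * τ ^ ((n : ℝ) - p - 1)) * U n with hE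
  set S := rlSeries p τ Φ - rlSeries p τ (leibniz X (fun n => U (n + 1)))
    - rlSeries p τ (leibniz Y V) + X 0 * rlSeries p τ (fun n => U (n + 1))
    + Y 0 * rlSeries p τ V with hS
  refine ⟨fun l => if l = i then E else 0, rlJetCoeff (Pi.single i p) a x, S, ?_, ?_, ?_, ?_⟩
  · intro l
    simp only [rlJet_single p a hij]
    rcases eq_or_ne l i with rfl | hl
    · simp only [Function.update_self, if_true, jet, mpd_single]
      have hd := hasDerivAt_rlSeries_explicit hτ p rU
      exact hd.comp_sub_const (x l) (a l)
    · simp only [Function.update_of_ne hl.symm, if_neg hl]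
      exact hasDerivAt_const _ _
  · intro σ
    exact hasDerivAt_rlJet_coord a x _ _ (summable_rlJetCoeff_mul p a hij h.above rU) σ _
  · rw [← (single_injective i).hasSum_iff]
    · have hs := (((((hasSum_rlSeries hτ p rΦ).sub
        (hasSum_rlSeries hτ p (rX.leibniz hτ rU'))).sub
        (hasSum_rlSeries hτ p (rY.leibniz hτ rV))).add
        ((hasSum_rlSeries hτ p rU').mul_left (X 0))).add
        ((hasSum_rlSeries hτ p rV).mul_left (Y 0)))
      refine hs.of_eq (fun n => ?_) rfl
      rw [Function.comp_apply, rlJetCoeff_single p a hij,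
        prolCoeff_single hij (hu x hxD) (hcomp hφ x hxD) fun l => hcomp (hξ l) x hxD]
      simp only [hU, hV, hΦ, hX, hY, Function.iterate_zero, id_eq]
      ring
    · intro σ hσ
      rw [rlJetCoeff_eq_zero p a hij x hσ, mul_zero]
  · have hE' : rlSeries (p + 1) τ U = E + rlSeries p τ (fun n => U (n + 1)) :=
      (rlSeries_succ hτ p rU).unique
        ((hasSum_rlCoeff_mul_sub hτ p rU).summable.hasSum.add (hasSum_rlSeries hτ p rU'))
    rw [formulaRHS, sSeries.tsum_eq, sOsler.tsum_eq, hser0, opU, opQ, opG, sum_eq_add_of_ne hij,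
      hE', hS]
    simp only [if_true, if_neg hij.symm, hG, hX, hY, Function.iterate_zero, id_eq,
      Function.iterate_one]
    ring

end Prolongation

/-! ### Points near the terminal are admissible -/

open scoped NNReal ENNReal in
lemma _root_.AnalyticAt.exists_iteratedDeriv_line_bound {E : Type*} [NormedAddCommGroup E]
    [NormedSpace ℝ E] {f : E → ℝ} {z₀ : E} (hf : AnalyticAt ℝ f z₀) {e : E} (he : ‖e‖ ≤ 1) :
    ∃ C r : ℝ, 0 < r ∧ ∀ᶠ z in 𝓝 z₀, ∀ (s₀ : ℝ) (n : ℕ),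
      |iteratedDeriv n (fun s : ℝ => f (z + (s - s₀) • e)) s₀| * r ^ n ≤ C * n.factorial := by
  obtain ⟨P, R, hP⟩ := hf
  obtain ⟨r, hr0, hrR⟩ := ENNReal.lt_iff_exists_nnreal_btwn.1 hP.r_pos
  have hr0' : 0 < r := by exact_mod_cast hr0
  obtain ⟨C, -, hC⟩ := hP.exists_iteratedDeriv_line_bound
    (r := r / 2) (r' := r / 2) (by rwa [add_halves]) he
  refine ⟨C, (r / 2 : ℝ≥0), by positivity, ?_⟩
  have hpos : (0 : ℝ) < (r / 2 : ℝ≥0) := by positivity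
  filter_upwards [Metric.closedBall_mem_nhds z₀ hpos] with z hz
  exact hC z (by rwa [← dist_eq_norm])

lemma update_eq_add_smul (x : Base) (i : Fin 2) (s : ℝ) :
    Function.update x i s = x + (s - x i) • (Pi.single i 1 : Base) := by
  funext l
  rcases eq_or_ne l i with rfl | hl
  · simp
  · simp [hl]

lemma norm_single_one_le (i : Fin 2) : ‖(Pi.single i 1 : Base)‖ ≤ 1 := by
  rw [pi_norm_le_iff_of_nonneg zero_le_one]
  intro l
  rcases eq_or_ne l i with rfl | hl
  · simp
  · simp [hl]

section NearTerminal

variable {x₀ : Base} {i : Fin 2} {a : ℝ}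

lemma taylorReaches_of_bound {f : Base → ℝ} {x : Base} {C r : ℝ} (hr : 0 < r) (hx : x i - a < r)
    (h : ∀ n : ℕ, |iteratedDeriv n (fun s => f (Function.update x i s)) (x i)| * r ^ n
      ≤ C * n.factorial) : TaylorReaches a i f x := by
  refine ⟨C, r, hx, fun n => ?_⟩
  rw [pd_iterate_eq, le_div_iff₀ (by positivity)]
  exact h n

lemma eventually_sub_lt (hx₀ : x₀ i = a) {r : ℝ} (hr : 0 < r) : ∀ᶠ x in 𝓝 x₀, x i - a < r := by
  have hc : ContinuousAt (fun x : Base => x i - a) x₀ :=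
    ((continuous_apply i).sub continuous_const).continuousAt
  exact hc.eventually_lt continuousAt_const (by simpa [hx₀] using hr)

lemma eventually_taylorReaches (hx₀ : x₀ i = a) {f : Base → ℝ} (hf : AnalyticAt ℝ f x₀) :
    ∀ᶠ x in 𝓝 x₀, TaylorReaches a i f x := by
  obtain ⟨C, r, hr, hb⟩ := hf.exists_iteratedDeriv_line_bound (norm_single_one_le i)
  filter_upwards [hb, eventually_sub_lt hx₀ hr] with x hx hxr
  refine taylorReaches_of_bound (C := C) hr hxr fun n => ?_
  simp only [update_eq_add_smul]
  exact hx (x i) n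

lemma eventually_taylorReaches_frozen (hx₀ : x₀ i = a) {u : Base → ℝ} (hu : ContinuousAt u x₀)
    {ψ : Base × ℝ → ℝ} (hψ : AnalyticAt ℝ ψ (x₀, u x₀)) :
    ∀ᶠ x in 𝓝 x₀, TaylorReaches a i (fun y => ψ (y, u x)) x := by
  have he : ‖((Pi.single i 1, 0) : Base × ℝ)‖ ≤ 1 := by
    rw [Prod.norm_def, norm_zero]
    exact max_le (norm_single_one_le i) zero_le_one
  obtain ⟨C, r, hr, hb⟩ := hψ.exists_iteratedDeriv_line_bound he
  have ht : Tendsto (fun x => (x, u x)) (𝓝 x₀) (𝓝 (x₀, u x₀)) := continuousAt_id.prodMk hu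
  filter_upwards [ht.eventually hb, eventually_sub_lt hx₀ hr] with x hx hxr
  refine taylorReaches_of_bound (C := C) hr hxr fun n => ?_
  simp only [update_eq_add_smul]
  simpa using hx (x i) n

/-- The segment down to the terminal stays in a small box. -/
lemma update_mem_ball (hx₀ : x₀ i = a) {x : Base} {ε s : ℝ} (hx : x ∈ Metric.ball x₀ ε)
    (hs : s ∈ Icc a (x i)) : Function.update x i s ∈ Metric.ball x₀ ε := by
  have hε : 0 < ε := Metric.pos_of_mem_ball hx
  rw [Metric.mem_ball, dist_pi_lt_iff hε] at hx ⊢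
  intro l
  rcases eq_or_ne l i with rfl | hl
  · have := hx l
    rw [Function.update_self, Real.dist_eq, hx₀]
    rw [Real.dist_eq, hx₀] at this
    rw [abs_of_nonneg (by linarith [hs.1])]
    linarith [hs.2, le_abs_self (x l - a)]
  · rw [Function.update_of_ne hl]
    exact hx l

end NearTerminal

theorem eventually_admissible {a : Fin 2 → ℝ} {M : Set (Base × ℝ)}
    (hM : ∃ V : Set (Base × ℝ), IsOpen V ∧ M = V ∩ (Ici a ×ˢ univ))
    {ξ : Fin 2 → Base × ℝ → ℝ} {φ : Base × ℝ → ℝ}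
    (hξ : ∀ l, AnalyticOnNhd ℝ (ξ l) M) (hφ : AnalyticOnNhd ℝ φ M)
    {D : Set Base} (hD : ∃ V : Set Base, IsOpen V ∧ D = V ∩ Ici a)
    {u : Base → ℝ} (hu : AnalyticOnNhd ℝ u D) (hgraph : ∀ x ∈ D, (x, u x) ∈ M) (i j : Fin 2)
    {x₀ : Base} (hx₀ : x₀ ∈ D) (hx₀i : x₀ i = a i) :
    ∀ᶠ x in 𝓝[Ici a ∩ {x | a i < x i}] x₀, Admissible D M ξ φ u a i j x := by
  obtain ⟨V, hV, rfl⟩ := hM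
  obtain ⟨W, hW, rfl⟩ := hD
  have hu₀ := hu x₀ hx₀
  have hM₀ := hgraph x₀ hx₀
  have hcomp : ∀ {ψ : Base × ℝ → ℝ}, AnalyticAt ℝ ψ (x₀, u x₀) →
      AnalyticAt ℝ (fun y => ψ (y, u y)) x₀ := fun {ψ} hψ =>
    AnalyticAt.fun_comp (g := ψ) (f := fun y => (y, u y)) hψ (analyticAt_id.prod hu₀)
  obtain ⟨ε, hε, hball⟩ := Metric.isOpen_iff.1 hW x₀ hx₀.1
  obtain ⟨δ, hδ, hballV⟩ := Metric.isOpen_iff.1 hV _ hM₀.1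
  have hupd : ∀ x ∈ Ici a, ∀ s ∈ Icc (a i) (x i), Function.update x i s ∈ Ici a := by
    intro x hx s hs l
    rcases eq_or_ne l i with rfl | hl
    · simpa using hs.1
    · simpa [hl] using hx l
  have hξ' : ∀ᶠ x in 𝓝 x₀, ∀ l, TaylorReaches (a i) i (fun y => ξ l (y, u y)) x :=
    eventually_all.2 fun l => eventually_taylorReaches hx₀i (hcomp (hξ l _ hM₀))
  filter_upwards [self_mem_nhdsWithin,
    nhdsWithin_le_nhds (Metric.ball_mem_nhds x₀ hε),
    nhdsWithin_le_nhds (Metric.ball_mem_nhds x₀ hδ),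
    nhdsWithin_le_nhds (hu₀.continuousAt (Metric.ball_mem_nhds (u x₀) hδ)),
    nhdsWithin_le_nhds (eventually_taylorReaches hx₀i hu₀),
    nhdsWithin_le_nhds (eventually_taylorReaches hx₀i (hu₀.pd j)),
    nhdsWithin_le_nhds (eventually_taylorReaches hx₀i (hcomp (hφ _ hM₀))),
    nhdsWithin_le_nhds hξ',
    nhdsWithin_le_nhds (eventually_taylorReaches_frozen hx₀i hu₀.continuousAt (hφ _ hM₀)),
    nhdsWithin_le_nhds (eventually_taylorReaches_frozen hx₀i hu₀.continuousAt (hφ _ hM₀).ud)]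
    with x hx hxε hxδ hux h1 h2 h3 h4 h5 h6
  refine ⟨hx.2, fun s hs => ⟨hball (update_mem_ball hx₀i hxε hs), hupd x hx.1 s hs⟩,
    fun s hs => ⟨hballV ?_, hupd x hx.1 s hs, mem_univ _⟩, h1, h2, h3, h4, h5, h6⟩
  rw [← ball_prod_same]
  exact ⟨update_mem_ball hx₀i hxδ hs, hux⟩

end FracLie

end

theorem mainTheorem3
    (a : Fin 2 → ℝ) (ha : a 1 = 0) (p : ℝ) (hp : 0 < p)
    -- the domain of the vector field, relatively open in `[a_0, ∞) × [a_1, ∞) × ℝ`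
    (M : Set (FracLie.Base × ℝ))
    (hM : ∃ V : Set (FracLie.Base × ℝ), IsOpen V ∧ M = V ∩ (Set.Ici a ×ˢ Set.univ))
    -- the vector field `ξ 0 ∂_x + ξ 1 ∂_t + φ ∂_u`
    (ξ : Fin 2 → FracLie.Base × ℝ → ℝ) (φ : FracLie.Base × ℝ → ℝ)
    (hξ : ∀ l, AnalyticOnNhd ℝ (ξ l) M) (hφ : AnalyticOnNhd ℝ φ M)
    -- the function `u`, with graph in `M`
    (D : Set FracLie.Base)
    (hD : ∃ V : Set FracLie.Base, IsOpen V ∧ D = V ∩ Set.Ici a)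
    (u : FracLie.Base → ℝ) (hu : AnalyticOnNhd ℝ u D)
    (hgraph : ∀ x ∈ D, (x, u x) ∈ M) :
    -- `i = 1`, `j = 0` is the formula for `φ^{0,p}`; `i = 0`, `j = 1` is the one for `φ^{p,0}`
    ∀ i j : Fin 2, i ≠ j →
      -- the lower terminal of `x_i` is invariant
      (∀ z ∈ M, z.1 i = a i → ξ i z = 0) →
      (∀ x, FracLie.Admissible D M ξ φ u a i j x →
        FracLie.ProlongationFormula ξ φ u p a i j x) ∧
      (∀ x₀ ∈ D, x₀ i = a i →
        ∀ᶠ x in 𝓝[Set.Ici a ∩ {x | a i < x i}] x₀,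
          FracLie.ProlongationFormula ξ φ u p a i j x) := by
  intro i j hij hinv
  refine ⟨fun x hx => hx.prolongationFormula hξ hφ hu hgraph hij hinv p, fun x₀ hx₀ hx₀i => ?_⟩
  exact (FracLie.eventually_admissible hM hξ hφ hD hu hgraph i j hx₀ hx₀i).mono fun x hx =>
    hx.prolongationFormula hξ hφ hu hgraph hij hinv p
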